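/- Let $G$ be a connected orientable graph of the noncommutative $\phi^4$ theory, i.e. a ribbon graph with $n\ge 1$ vertices, each having four corners numbered $1,2,3,4$ in cyclic order, and $L$ lines, each joining two distinct corners; every corner is the end of at most one line (a corner that is the end of no line bears an external leg). Orientable means that each corner can be given a sign so that the signs alternate around every vertex and the two ends of each line have opposite signs. Let $F$ be the number of faces of $G$ (external legs being ignored). Then $2-2g=n-L+F$ for a unique integer $g\ge 0$, the genus. Fix a root vertex $\bar v$. Order each line arbitrarily, from one of its corners to the other. Put $\epsilon_{li}=1$ if the line $l$ enters at the corner $i$, $-1$ if it exits at $i$, and $0$ otherwise; $\eta_{li}=|\epsilon_{li}|$; and for corners of one vertex $\omega(i,j)=1$ if $i<j$, $\omega(i,j)=-1$ if $i>j$. For $a,b\in\{\epsilon,\eta\}$ let $$E^{ab}_{l,l'}=\sum_v\sum_{i\neq j;\ i,j\in v}(-1)^{i+j+1}\omega(i,j)\,a_{li}\,b_{l'j},\qquad C^{a}_{l,v}=\sum_{i\in v}(-1)^{i+1}a_{li}\quad(v\neq\bar v),$$ and let $B'$ be the antisymmetric integer matrix of size $2L+n-1$ $$B'=\begin{pmatrix}E^{\epsilon\epsilon}&E^{\epsilon\eta}&C^{\epsilon}\\-(E^{\epsilon\eta})^{t}&E^{\eta\eta}&C^{\eta}\\-(C^{\epsilon})^{t}&-(C^{\eta})^{t}&0\end{pmatrix}.$$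 The first $L$ indices of $B'$ are the short variables of the lines, the next $L$ indices the long variables, the last $n-1$ indices the hypermomenta of the vertices $v\ne\bar v$. For sets of lines $I,J$ let $n_{I,J}=\mathrm{Pf}(B'_{\hat I\hat J})$ be the Pfaffian of the matrix obtained from $B'$ by deleting the rows and columns of the short variables of the lines in $I$ and of the long variables of the lines in $J$. (The squares $n_{I,J}^2$ are the integer coefficients in the expansion of the first hyperbolic polynomial $HU_{G,\bar v}$.) A set $J$ of lines is called admissible if (a) $J$ contains a spanning tree of the dual graph of $G$ (whose vertices are the faces of $G$), and (b) the complement of $J$ contains a spanning tree $T$ of $G$ such that the rosette obtained from $G$ by removing the lines of $J$ and contracting the lines of $T$ is a superrosette, i.e. has exactly one vertex and one face. Let $I$ be the set of all lines, and put $k_J=|J|-F+1$. Then for every set $J$ of lines, $n_{I,J}\neq 0$ if and only if $J$ is admissible; and if $J$ is admissible, then $k_J$ is even, $0\le k_J\le 2g$, and $n_{I,J}^2=2^{2g-k_J}$. -/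

import Mathlib

/-- The Pfaffian of a (skew-symmetric) matrix whose rows and columns are indexed by a finite
linearly ordered set: the sum over all pairings of the indices (encoded as fixed-point-free
involutions `π`) of the products of the entries `A i (π i)` with `i < π i`, each with the sign
`(-1) ^ c`, where `c` is the number of crossings `i < j < π i < π j` of the pairing.
It is `0` when the number of indices is odd and `1` when there are no indices. -/
def pfaffian {ι R : Type*} [Fintype ι] [LinearOrder ι] [CommRing R] (A : Matrix ι ι R) : R :=
  ∑ π ∈ (Finset.univ : Finset (Equiv.Perm ι)).filter
      (fun π => (∀ i, π (π i) = i) ∧ ∀ i, π i ≠ i),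
    (-1) ^ ((Finset.univ : Finset (ι × ι)).filter
        (fun p => p.1 < p.2 ∧ p.2 < π p.1 ∧ π p.1 < π p.2)).card *
      ∏ i ∈ Finset.univ.filter (fun i => i < π i), A i (π i)

/-- A ribbon graph. `D` is the set of corners, `rot` sends a corner to the next one in the cyclic
order around its vertex, so that the vertices are the cycles of `rot`. The lines are the elements
of `lines`; a line `e` joins the corners `source e` and `target e`, and distinct line ends sit at
distinct corners. A corner which is not an end of a line of the graph bears an external leg. -/
structure RibbonGraph (D E : Type*) where
  rot : Equiv.Perm D
  source : E → D
  target : E → D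
  ends_injective : Function.Injective (Sum.elim source target)
  lines : Finset E

namespace RibbonGraph

variable {D E : Type*} [DecidableEq D] [DecidableEq E]

/-- The involution of the corners which exchanges the two ends of every line in `S` and fixes
all other corners (a product of disjoint transpositions, so the order of the factors is
irrelevant). -/
noncomputable def flip (G : RibbonGraph D E) (S : Finset E) : Equiv.Perm D :=
  (S.toList.map fun e => Equiv.swap (G.source e) (G.target e)).prod

/-- The vertices: cycles of `rot` (fixed points included). -/
abbrev Vertex (G : RibbonGraph D E) : Type _ := Quotient (Equiv.Perm.SameCycle.setoid G.rot)

/-- The permutation whose cycles are the boundaries of the faces: follow the line from a corner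
to its other end (stay in place at an external leg) and turn to the next corner there. -/
noncomputable def faceRot (G : RibbonGraph D E) : Equiv.Perm D := G.rot * G.flip G.lines

/-- The dual ribbon graph, which exchanges faces and vertices and has the same lines. -/
noncomputable def dual (G : RibbonGraph D E) : RibbonGraph D E where
  rot := G.faceRot
  source := G.source
  target := G.target
  ends_injective := G.ends_injective
  lines := G.lines

noncomputable def numVertices (G : RibbonGraph D E) : ℕ := Nat.card G.Vertex

noncomputable def numFaces (G : RibbonGraph D E) : ℕ := Nat.card G.dual.Vertex

/-- Two distinct vertices are adjacent when a line of `S` joins them. -/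
def graphOf (G : RibbonGraph D E) (S : Finset E) : SimpleGraph G.Vertex :=
  SimpleGraph.fromRel fun v w =>
    ∃ e ∈ S, v = (⟦G.source e⟧ : G.Vertex) ∧ w = (⟦G.target e⟧ : G.Vertex)

/-- The graph is connected. -/
def IsConnected (G : RibbonGraph D E) : Prop := (G.graphOf G.lines).Connected

/-- `T` is (the set of lines of) a spanning tree: its lines connect all the vertices, and there is
one line less than there are vertices. -/
def IsTree (G : RibbonGraph D E) (T : Finset E) : Prop :=
  T ⊆ G.lines ∧ (G.graphOf T).Connected ∧ T.card + 1 = G.numVertices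

/-- Removal of the lines of `J`; their corners become external. -/
def remove (G : RibbonGraph D E) (J : Finset E) : RibbonGraph D E where
  rot := G.rot
  source := G.source
  target := G.target
  ends_injective := G.ends_injective
  lines := G.lines \ J

/-- Contraction of the lines of `T`. For a line with ends `a` and `b` the new cyclic order is
`a ↦ rot b`, `b ↦ rot a`: the corners of the vertex of `b`, read from `b` on, are inserted in the
cyclic order at the place of `a`. The corners `a` and `b` stay as corners without a line, which
changes neither the vertices and faces nor the cyclic order of the remaining line ends. -/
noncomputable def contract (G : RibbonGraph D E) (T : Finset E) : RibbonGraph D E where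
  rot := G.rot * G.flip T
  source := G.source
  target := G.target
  ends_injective := G.ends_injective
  lines := G.lines \ T

/-- A superrosette has exactly one vertex and exactly one face. -/
def IsSuperrosette (G : RibbonGraph D E) : Prop := G.numVertices = 1 ∧ G.numFaces = 1

/-- `J` is admissible: it contains a tree of the dual graph, and its complement contains a tree `T`
of the direct graph such that removing `J` and contracting `T` leaves a superrosette. -/
def IsAdmissible (G : RibbonGraph D E) (J : Finset E) : Prop :=
  (∃ T' ⊆ J, G.dual.IsTree T') ∧
    ∃ T ⊆ G.lines \ J, G.IsTree T ∧ ((G.remove J).contract T).IsSuperrosette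

end RibbonGraph

/-- A graph of the noncommutative `φ⁴` theory with `n` vertices and `L` internal lines. Every
vertex `v` has four corners `(v, 0), …, (v, 3)`, in this cyclic order (corners
`1, …, 4` in the usual numbering). The line `l` exits at the corner `source l` and enters at the corner `target l`; a
corner bears at most one line end, and bears an external field if it bears none. -/
structure Phi4Graph (n L : ℕ) where
  source : Fin L → Fin n × Fin 4
  target : Fin L → Fin n × Fin 4
  ends_injective : Function.Injective (Sum.elim source target)

namespace Phi4Graph

variable {n L : ℕ}

/-- The underlying ribbon graph. -/
def toRibbon (G : Phi4Graph n L) : RibbonGraph (Fin n × Fin 4) (Fin L) where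
  rot := Equiv.prodCongr (Equiv.refl (Fin n)) (Equiv.addRight 1)
  source := G.source
  target := G.target
  ends_injective := G.ends_injective
  lines := Finset.univ

/-- The graph is orientable: signs (entering or exiting) can be given to all the corners so that
they alternate around every vertex and the two ends of every line have opposite signs. -/
def IsOrientable (G : Phi4Graph n L) : Prop :=
  ∃ s : Fin n × Fin 4 → ℤˣ, (∀ v i, s (v, i + 1) = -s (v, i)) ∧
    ∀ l, s (G.source l) = -s (G.target l)

/-- The incidence number `ε` of a line and a corner: `1` if the line enters there, `-1` if it exits
there, `0` otherwise. -/
def eps (G : Phi4Graph n L) (l : Fin L) (c : Fin n × Fin 4) : ℤ :=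
  if G.target l = c then 1 else if G.source l = c then -1 else 0

/-- `η = |ε|`. -/
def eta (G : Phi4Graph n L) (l : Fin L) (c : Fin n × Fin 4) : ℤ := |G.eps l c|

/-- `ω(i, j)` is `1` if `i < j` and `-1` if `i > j`. -/
def omega (i j : Fin 4) : ℤ := if i < j then 1 else -1

/-- The vertex oscillation form
`∑_v ∑_{i ≠ j; i, j ∈ v} (-1)^(i+j+1) ω(i,j) a_{l i} b_{l' j}`
for `a, b` among `ε, η`. (The sign is the same for corners numbered from `0` or from `1`.) -/
def osc (a b : Fin L → Fin n × Fin 4 → ℤ) : Matrix (Fin L) (Fin L) ℤ :=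
  Matrix.of fun l l' => ∑ v : Fin n, ∑ p ∈ (Finset.univ : Finset (Fin 4)).offDiag,
    (-1) ^ ((p.1 : ℕ) + (p.2 : ℕ) + 1) * omega p.1 p.2 * a l (v, p.1) * b l' (v, p.2)

/-- The hypermomentum oscillations `∑_{i ∈ v} (-1)^(i+1) a_{l i}` (corners numbered from `1`, so
that the sign is `(-1)^i` for corners numbered from `0`), one column for each vertex other than
the root `r`, for `a` one of `ε, η`. -/
def hyp (r : Fin n) (a : Fin L → Fin n × Fin 4 → ℤ) : Matrix (Fin L) {v : Fin n // v ≠ r} ℤ :=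
  Matrix.of fun l v => ∑ i : Fin 4, (-1) ^ (i : ℕ) * a l (v.1, i)

/-- The integer matrix `B' = [[E, C], [-Cᵗ, 0]]` in the short variables `u` (first block), the long
variables `v` (second block) and the hypermomenta of the vertices other than `r` (third block);
`E` has the blocks `E^{uu}, E^{uv}, E^{vu}, E^{vv}`, where `E^{vu} = -(E^{uv})ᵗ`. -/
def oscMatrix (G : Phi4Graph n L) (r : Fin n) :
    Matrix (Fin L ⊕ (Fin L ⊕ {v : Fin n // v ≠ r})) (Fin L ⊕ (Fin L ⊕ {v : Fin n // v ≠ r})) ℤ :=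
  Matrix.fromBlocks
    (osc G.eps G.eps)
    (Matrix.fromCols (osc G.eps G.eta) (hyp r G.eps))
    (Matrix.fromRows (-(osc G.eps G.eta).transpose) (-(hyp r G.eps).transpose))
    (Matrix.fromBlocks (osc G.eta G.eta) (hyp r G.eta) (-(hyp r G.eta).transpose) 0)

/-- Forget the order of the variables. -/
def unlex {r : Fin n} (x : Fin L ⊕ₗ (Fin L ⊕ₗ {v : Fin n // v ≠ r})) :
    Fin L ⊕ (Fin L ⊕ {v : Fin n // v ≠ r}) :=
  Sum.map id ofLex (ofLex x)

/-- `n_{I,J}`: the Pfaffian of `B'` after deletion of the rows and columns of the short variables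
of the lines in `I` and of the long variables of the lines in `J`. The variables are ordered as
`u_1, …, u_L, v_1, …, v_L`, then the hypermomenta. -/
def pfCoeff (G : Phi4Graph n L) (r : Fin n) (I J : Finset (Fin L)) : ℤ :=
  pfaffian ((G.oscMatrix r).submatrix
    (fun x : {x : Fin L ⊕ₗ (Fin L ⊕ₗ {v : Fin n // v ≠ r}) //
      unlex x ∉ I.disjSum (J.disjSum ∅)} => unlex x.1)
    (fun x => unlex x.1))

/-- The number `F` of faces. -/
noncomputable def F (G : Phi4Graph n L) : ℕ := G.toRibbon.numFaces

/-- `k_J = |J| - F + 1`. -/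
noncomputable def k (G : Phi4Graph n L) (J : Finset (Fin L)) : ℤ := (J.card : ℤ) - G.F + 1

end Phi4Graph

/-! With all short variables deleted, only the long variables of the lines outside `J` and the
hypermomenta remain. Orientability absorbs the factors `(-1)^(i+j)` into signs of the corners: if
`K` is the signed incidence matrix of corners and remaining lines and `Ω = orderMat n`, the line
block is `-Kᵀ Ω K`, and the hypermomentum block is `Kᵀ * vertexMat r` up to signs of columns. So
`n_{I,J}²` is the absolute value of the determinant of `oscForm` (`pfCoeff_sq`). This rests on `Pf²
= ± det`, which follows from `Pf(B A Bᵀ) = det B · Pf A` and a symplectic basis; the sign is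
irrelevant once absolute values are taken.

The determinant comes from evaluating one larger matrix, indexed by corners and lines, in two ways.
Let `P` be the rotation of the corners and `α` the exchange of the ends of the lines outside `J`.
Two identities drive the computation: `K Kᵀ = 1 - α`, and `(P - 1) Ω = -(P + 1)` plus a vertex term.
Eliminating the lines gives `2^(L - |J|) det (P - α + E)`, where `E` is a single entry at the root
(`det_cornerForm`); this last determinant is `±1` if `P α` is one cycle and `0` otherwise.
Eliminating the corners gives `±2^(n-1) det (oscForm r K)` (`det_cornerForm_eq_det_oscForm`). Hence
`2^(n-1) n_{I,J}²` is `2^(L - |J|)` or `0`.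

The cycles of `P α` are the boundary components left after removal of `J`. A single component
already forces the trees in the graph and in its dual, so it is equivalent to admissibility
(`isAdmissible_iff`). Euler's relation turns `L - |J| - (n - 1)` into `2g - k_J`, the sizes of the
two trees give `0 ≤ k_J ≤ 2g`, and the sign of `P α` gives the parity. -/

set_option linter.unusedSectionVars false

/-! ### The Pfaffian as an alternating function of vectors, and its behaviour under congruence. -/

section Pfaffian

open Finset Matrix

variable {ι R V : Type*} [Fintype ι] [LinearOrder ι] [CommRing R] [AddCommGroup V] [Module R V]

/-- The fixed-point-free involutions, which encode the pairings of the indices. -/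
def pairings (ι : Type*) [Fintype ι] [DecidableEq ι] : Finset (Equiv.Perm ι) :=
  univ.filter fun π => (∀ i, π (π i) = i) ∧ ∀ i, π i ≠ i

/-- The crossings of a pairing. -/
def crossings (π : Equiv.Perm ι) : Finset (ι × ι) :=
  univ.filter fun p => p.1 < p.2 ∧ p.2 < π p.1 ∧ π p.1 < π p.2

theorem pfaffian_eq_sum (A : Matrix ι ι R) :
    pfaffian A = ∑ π ∈ pairings ι,
      (-1) ^ (crossings π).card * ∏ i ∈ univ.filter (fun i => i < π i), A i (π i) := by
  unfold pfaffian pairings crossings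
  congr!

theorem mem_pairings {π : Equiv.Perm ι} :
    π ∈ pairings ι ↔ (∀ i, π (π i) = i) ∧ ∀ i, π i ≠ i := by simp [pairings]

/-- In the product over a pairing, each index occurs in exactly one factor. -/
theorem exists_prod_update_eq (f : V →ₗ[R] V →ₗ[R] R) {π : Equiv.Perm ι} (hπ : π ∈ pairings ι)
    (b : ι → V) (k : ι) : ∃ φ : V →ₗ[R] R, ∀ x,
      ∏ i ∈ univ.filter (fun i => i < π i),
        f (Function.update b k x i) (Function.update b k x (π i)) = φ x := by
  obtain ⟨h1, h2⟩ := mem_pairings.1 hπ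
  rcases lt_or_gt_of_ne (h2 k) with h | h
  · refine ⟨(∏ i ∈ (univ.filter (fun i => i < π i)).erase (π k), f (b i) (b (π i))) •
      f (b (π k)), fun x => ?_⟩
    rw [← mul_prod_erase _ _ (a := π k) (by simp [h1, h])]
    rw [h1, Function.update_self, Function.update_of_ne (h2 k), LinearMap.smul_apply, smul_eq_mul,
      mul_comm]
    congr 1
    refine prod_congr rfl fun i hi => ?_
    simp only [mem_erase, mem_filter, mem_univ, true_and] at hi
    have e1 : i ≠ k := by rintro rfl; exact lt_asymm h hi.2
    have e2 : π i ≠ k := by rintro rfl; exact hi.1 (h1 i).symm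
    rw [Function.update_of_ne e1, Function.update_of_ne e2]
  · refine ⟨(∏ i ∈ (univ.filter (fun i => i < π i)).erase k, f (b i) (b (π i))) •
      f.flip (b (π k)), fun x => ?_⟩
    rw [← mul_prod_erase _ _ (a := k) (by simp [h])]
    rw [Function.update_self, Function.update_of_ne (h2 k), LinearMap.smul_apply, smul_eq_mul,
      mul_comm, LinearMap.flip_apply]
    congr 1
    refine prod_congr rfl fun i hi => ?_
    simp only [mem_erase, mem_filter, mem_univ, true_and] at hi
    have e2 : π i ≠ k := by rintro rfl; rw [h1] at h; exact lt_asymm h hi.2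
    rw [Function.update_of_ne hi.1, Function.update_of_ne e2]

/-- Two families with `i`, `j` adjacent: conjugation by the transposition preserves the order of
all pairs other than `(i, j)`. -/
theorem swap_lt_swap_of_covBy {i j x y : ι} (hij : i ⋖ j) (hxy : x < y)
    (h : ¬ (x = i ∧ y = j)) : Equiv.swap i j x < Equiv.swap i j y := by
  have hlt := hij.1
  have hcov : ∀ z, i < z → j ≤ z := fun z hz => not_lt.1 (hij.2 hz)
  have hcov' : ∀ z, z < j → z ≤ i := fun z hz => not_lt.1 fun h' => hij.2 h' hz
  simp only [Equiv.swap_apply_def]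
  split_ifs <;> subst_vars
  · exact absurd hxy (lt_irrefl _)
  · simp at h
  · exact lt_of_le_of_ne (hcov _ hxy) (Ne.symm ‹_›)
  · exact absurd hxy (lt_asymm hlt)
  · exact absurd hxy (lt_irrefl _)
  · exact hlt.trans hxy
  · exact hxy.trans hlt
  · exact lt_of_le_of_ne (hcov' _ hxy) ‹_›
  · exact hxy

/-- The conjugate of a permutation by the transposition of `i` and `j`. -/
def conjSwap (i j : ι) (π : Equiv.Perm ι) : Equiv.Perm ι :=
  Equiv.swap i j * π * Equiv.swap i j

theorem conjSwap_apply (i j : ι) (π : Equiv.Perm ι) (x : ι) :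
    conjSwap i j π x = Equiv.swap i j (π (Equiv.swap i j x)) := rfl

theorem conjSwap_conjSwap (i j : ι) (π : Equiv.Perm ι) :
    conjSwap i j (conjSwap i j π) = π := by
  ext x; simp [conjSwap_apply]

theorem conjSwap_mem {i j : ι} {π : Equiv.Perm ι} (hπ : π ∈ pairings ι) :
    conjSwap i j π ∈ pairings ι := by
  obtain ⟨h1, h2⟩ := mem_pairings.1 hπ
  refine mem_pairings.2 ⟨fun x => by simp [conjSwap_apply, h1], fun x h => ?_⟩
  rw [conjSwap_apply, Equiv.swap_apply_eq_iff] at h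
  exact h2 _ h

theorem prod_conjSwap (f : V →ₗ[R] V →ₗ[R] R) {i j : ι} (hij : i ⋖ j) {π : Equiv.Perm ι}
    (hπ : π ∈ pairings ι) (hne : π i ≠ j) {b : ι → V} (hb : b i = b j) :
    ∏ k ∈ univ.filter (fun k => k < conjSwap i j π k), f (b k) (b (conjSwap i j π k)) =
      ∏ k ∈ univ.filter (fun k => k < π k), f (b k) (b (π k)) := by
  obtain ⟨h1, h2⟩ := mem_pairings.1 hπ
  have hbs : ∀ x, b (Equiv.swap i j x) = b x := fun x => by
    rw [Equiv.swap_apply_def]; split_ifs <;> simp [*]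
  refine prod_nbij' (Equiv.swap i j) (Equiv.swap i j) ?_ ?_ (by simp) (by simp) ?_
  · intro k hk
    simp only [mem_filter, mem_univ, true_and] at hk ⊢
    have := swap_lt_swap_of_covBy hij hk (by
      rintro ⟨rfl, h⟩
      rw [conjSwap_apply, Equiv.swap_apply_left, Equiv.swap_apply_eq_iff,
        Equiv.swap_apply_right] at h
      rw [← h, h1] at hne; exact hne rfl)
    simpa [conjSwap_apply] using this
  · intro k hk
    simp only [mem_filter, mem_univ, true_and] at hk ⊢
    have := swap_lt_swap_of_covBy hij hk (by rintro ⟨rfl, h⟩; exact hne h)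
    simpa [conjSwap_apply] using this
  · intro k _
    simp [conjSwap_apply, hbs]

/-- The index `x` lies on one of the arcs at `i` and `j`. -/
def OnArcs (i j : ι) (π : Equiv.Perm ι) (x : ι) : Prop :=
  x = i ∨ x = j ∨ x = π i ∨ x = π j

instance (i j : ι) (π : Equiv.Perm ι) (x : ι) : Decidable (OnArcs i j π x) := by
  unfold OnArcs; infer_instance

theorem OnArcs.of_apply {i j : ι} {π : Equiv.Perm ι} (hπ : ∀ x, π (π x) = x) {x : ι}
    (h : OnArcs i j π (π x)) : OnArcs i j π x := by
  rcases h with h | h | h | h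
  · exact Or.inr (Or.inr (Or.inl (by rw [← h, hπ])))
  · exact Or.inr (Or.inr (Or.inr (by rw [← h, hπ])))
  · exact Or.inl (π.injective h)
  · exact Or.inr (Or.inl (π.injective h))

theorem OnArcs.conjSwap {i j : ι} {π : Equiv.Perm ι} {x : ι}
    (h : OnArcs i j π x) : OnArcs i j (conjSwap i j π) (Equiv.swap i j x) := by
  unfold OnArcs at *
  simp only [conjSwap_apply, Equiv.swap_apply_left, Equiv.swap_apply_right]
  rcases h with rfl | rfl | rfl | rfl <;> simp

/-- The crossings among the arcs at `i` and `j`. -/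
def crossingsAt (i j : ι) (π : Equiv.Perm ι) : Finset (ι × ι) :=
  (crossings π).filter fun p => OnArcs i j π p.1 ∧ OnArcs i j π p.2

/-- Two arcs cross at most once, and the crossing is recorded at the pair of their left ends. The
hypotheses list the relative positions of the partners of `i` and `j`, crossing ones first. -/
theorem card_crossingsAt {i j : ι} (hij : i < j) {π : Equiv.Perm ι}
    (hπ : π ∈ pairings ι) :
    (((j < π i ∧ π i < π j) ∨ (π j < i ∧ j < π i) ∨ (π i < π j ∧ π j < i)) →
      (crossingsAt i j π).card = 1) ∧
    (((j < π j ∧ π j < π i) ∨ (π i < i ∧ j < π j) ∨ (π j < π i ∧ π i < i)) →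
      (crossingsAt i j π).card = 0) := by
  obtain ⟨h1, h2⟩ := mem_pairings.1 hπ
  have hi := h1 i
  have hj := h1 j
  refine ⟨fun h => ?_, fun h => ?_⟩
  · rw [card_eq_one]
    rcases h with h | h | h
    · refine ⟨(i, j), ?_⟩
      ext ⟨x, y⟩
      simp only [crossingsAt, crossings, mem_filter, mem_univ, true_and, mem_singleton,
        Prod.mk.injEq]
      simp only [OnArcs]
      constructor
      · rintro ⟨h', hx | hx | hx | hx, hy | hy | hy | hy⟩ <;> subst hx <;> subst hy <;>
          (try simp only [hi, hj] at h') <;> first | exact ⟨rfl, rfl⟩ | (exfalso; order)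
      · rintro ⟨rfl, rfl⟩
        exact ⟨⟨hij, h.1, h.2⟩, Or.inl rfl, Or.inr (Or.inl rfl)⟩
    · refine ⟨(π j, i), ?_⟩
      ext ⟨x, y⟩
      simp only [crossingsAt, crossings, mem_filter, mem_univ, true_and, mem_singleton,
        Prod.mk.injEq]
      simp only [OnArcs]
      constructor
      · rintro ⟨h', hx | hx | hx | hx, hy | hy | hy | hy⟩ <;> subst hx <;> subst hy <;>
          (try simp only [hi, hj] at h') <;> first | exact ⟨rfl, rfl⟩ | (exfalso; order)
      · rintro ⟨rfl, rfl⟩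
        rw [hj]
        exact ⟨⟨h.1, hij, h.2⟩, Or.inr (Or.inr (Or.inr rfl)), Or.inl rfl⟩
    · refine ⟨(π i, π j), ?_⟩
      ext ⟨x, y⟩
      simp only [crossingsAt, crossings, mem_filter, mem_univ, true_and, mem_singleton,
        Prod.mk.injEq]
      simp only [OnArcs]
      constructor
      · rintro ⟨h', hx | hx | hx | hx, hy | hy | hy | hy⟩ <;> subst hx <;> subst hy <;>
          (try simp only [hi, hj] at h') <;> first | exact ⟨rfl, rfl⟩ | (exfalso; order)
      · rintro ⟨rfl, rfl⟩
        rw [hi, hj]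
        exact ⟨⟨h.1, h.2, hij⟩, Or.inr (Or.inr (Or.inl rfl)), Or.inr (Or.inr (Or.inr rfl))⟩
  · rw [card_eq_zero, eq_empty_iff_forall_notMem]
    rintro ⟨x, y⟩
    simp only [crossingsAt, crossings, mem_filter, mem_univ, true_and]
    simp only [OnArcs]
    rintro ⟨h', hx | hx | hx | hx, hy | hy | hy | hy⟩ <;> subst hx <;> subst hy <;>
      (try simp only [hi, hj] at h') <;>
        first
        | order
        | (rcases h with h | h | h <;> order)

/-- Conjugation exchanges the partners of `i` and `j`. As no index lies between `i` and `j`, this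
turns a crossing of the two arcs into a non-crossing and conversely. -/
theorem card_crossingsAt_conjSwap {i j : ι} (hij : i ⋖ j) {π : Equiv.Perm ι}
    (hπ : π ∈ pairings ι) (hne : π i ≠ j) :
    (crossingsAt i j π).card + (crossingsAt i j (conjSwap i j π)).card = 1 := by
  obtain ⟨h1, h2⟩ := mem_pairings.1 hπ
  have hlt := hij.1
  have hji : π j ≠ i := fun h => hne (by rw [← h, h1])
  have e1 : conjSwap i j π i = π j := by
    rw [conjSwap_apply, Equiv.swap_apply_left, Equiv.swap_apply_of_ne_of_ne hji (h2 j)]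
  have e2 : conjSwap i j π j = π i := by
    rw [conjSwap_apply, Equiv.swap_apply_right, Equiv.swap_apply_of_ne_of_ne (h2 i) hne]
  have hp : π i < i ∨ j < π i := by
    rcases lt_or_gt_of_ne (h2 i) with h | h
    · exact Or.inl h
    · exact Or.inr (lt_of_le_of_ne (not_lt.1 (hij.2 h)) (Ne.symm hne))
  have hq : π j < i ∨ j < π j := by
    rcases lt_or_gt_of_ne (h2 j) with h | h
    · exact Or.inl (lt_of_le_of_ne (not_lt.1 fun h' => hij.2 h' h) hji)
    · exact Or.inr h
  have hpq : π i ≠ π j := fun h => hlt.ne (π.injective h)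
  obtain ⟨a1, a0⟩ := card_crossingsAt hlt hπ
  obtain ⟨b1, b0⟩ := card_crossingsAt hlt (conjSwap_mem (i := i) (j := j) hπ)
  rw [e1, e2] at b1 b0
  have hcase : ((j < π i ∧ π i < π j) ∨ (π j < i ∧ j < π i) ∨ (π i < π j ∧ π j < i)) ∨
      ((j < π j ∧ π j < π i) ∨ (π i < i ∧ j < π j) ∨ (π j < π i ∧ π i < i)) := by
    rcases hp with hp | hp <;> rcases hq with hq | hq <;> rcases lt_or_gt_of_ne hpq with h | h <;>
      simp [*]
  rcases hcase with h | h
  · rw [a1 h, b0 h]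
  · rw [a0 h, b1 h]

/-- The transposition spoils only the comparison of `i` with `j`, and a crossing makes this
comparison only when both its arcs are the ones at `i` and `j`. -/
theorem crossings_conjSwap_sdiff {i j : ι} (hij : i ⋖ j) {π : Equiv.Perm ι}
    (hπ : π ∈ pairings ι) {p : ι × ι}
    (hp : p ∈ crossings π \ crossingsAt i j π) :
    Prod.map (Equiv.swap i j) (Equiv.swap i j) p ∈
      crossings (conjSwap i j π) \ crossingsAt i j (conjSwap i j π) := by
  obtain ⟨h1, h2⟩ := mem_pairings.1 hπ
  obtain ⟨x, y⟩ := p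
  simp only [crossingsAt, crossings, mem_sdiff, mem_filter, mem_univ, true_and,
    Prod.map] at hp ⊢
  obtain ⟨hc, h⟩ := hp
  have hn : ¬ (OnArcs i j π x ∧ OnArcs i j π y) := fun h' => h ⟨hc, h'⟩
  obtain ⟨a, b, c⟩ := hc
  have oi : OnArcs i j π i := Or.inl rfl
  have oj : OnArcs i j π j := Or.inr (Or.inl rfl)
  have A := swap_lt_swap_of_covBy hij a fun h => hn ⟨by rwa [h.1], by rwa [h.2]⟩
  have B := swap_lt_swap_of_covBy hij b fun h =>
    hn ⟨OnArcs.of_apply h1 (by rwa [h.2]), by rwa [h.1]⟩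
  have C := swap_lt_swap_of_covBy hij c fun h =>
    hn ⟨OnArcs.of_apply h1 (by rwa [h.1]), OnArcs.of_apply h1 (by rwa [h.2])⟩
  refine ⟨⟨A, by simpa [conjSwap_apply] using B, by simpa [conjSwap_apply] using C⟩, fun h' => ?_⟩
  have := h'.2.1.conjSwap
  have := h'.2.2.conjSwap
  simp only [conjSwap_conjSwap, Equiv.swap_apply_self] at *
  exact hn ⟨by assumption, by assumption⟩

theorem neg_one_pow_card_crossings_conjSwap {i j : ι} (hij : i ⋖ j) {π : Equiv.Perm ι}
    (hπ : π ∈ pairings ι) (hne : π i ≠ j) :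
    (-1 : R) ^ (crossings (conjSwap i j π)).card = -(-1) ^ (crossings π).card := by
  have hc : (crossings π \ crossingsAt i j π).card =
      (crossings (conjSwap i j π) \ crossingsAt i j (conjSwap i j π)).card := by
    refine card_nbij' (Prod.map (Equiv.swap i j) (Equiv.swap i j))
      (Prod.map (Equiv.swap i j) (Equiv.swap i j)) ?_ ?_ ?_ ?_
    · intro p hp; exact crossings_conjSwap_sdiff hij hπ hp
    · intro p hp
      have := crossings_conjSwap_sdiff hij (conjSwap_mem (i := i) (j := j) hπ) hp
      rwa [conjSwap_conjSwap] at this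
    · intro p _; ext <;> simp
    · intro p _; ext <;> simp
  have s1 := card_sdiff_add_card_eq_card (s := crossingsAt i j π) (t := crossings π)
    (filter_subset _ _)
  have s2 := card_sdiff_add_card_eq_card (s := crossingsAt i j (conjSwap i j π))
    (t := crossings (conjSwap i j π)) (filter_subset _ _)
  have s3 := card_crossingsAt_conjSwap hij hπ hne
  rw [← s1, ← s2, ← hc, pow_add, pow_add]
  rcases Nat.lt_or_ge 0 (crossingsAt i j π).card with h | h
  · rw [show (crossingsAt i j π).card = 1 by omega,
      show (crossingsAt i j (conjSwap i j π)).card = 0 by omega]; simp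
  · rw [show (crossingsAt i j π).card = 0 by omega,
      show (crossingsAt i j (conjSwap i j π)).card = 1 by omega]; simp

/-- The Pfaffian of the Gram matrix of a family of vectors with respect to a bilinear form, as a
multilinear function of the family. -/
def pfaffianMultilinear (ι : Type*) [Fintype ι] [LinearOrder ι] (f : V →ₗ[R] V →ₗ[R] R) :
    MultilinearMap R (fun _ : ι => V) R where
  toFun b := pfaffian (Matrix.of fun i j => f (b i) (b j))
  map_update_add' {d} b k x y := by
    obtain rfl : d = LinearOrder.toDecidableEq := Subsingleton.elim _ _
    simp only [pfaffian_eq_sum, Matrix.of_apply, ← sum_add_distrib]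
    refine sum_congr rfl fun π hπ => ?_
    obtain ⟨φ, hφ⟩ := exists_prod_update_eq f hπ b k
    rw [hφ, hφ, hφ, map_add, mul_add]
  map_update_smul' {d} b k c x := by
    obtain rfl : d = LinearOrder.toDecidableEq := Subsingleton.elim _ _
    simp only [pfaffian_eq_sum, Matrix.of_apply, smul_sum]
    refine sum_congr rfl fun π hπ => ?_
    obtain ⟨φ, hφ⟩ := exists_prod_update_eq f hπ b k
    rw [hφ, hφ, map_smul, smul_eq_mul, smul_eq_mul, mul_left_comm]

/-- Conjugation by the transposition is an involution of the pairings that reverses the sign and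
keeps the product. The pairings that match `i` with `j` contribute zero because the form is
alternating. -/
theorem pfaffianMultilinear_eq_zero_of_covBy {f : V →ₗ[R] V →ₗ[R] R} (hf : f.IsAlt) {b : ι → V}
    {i j : ι} (hij : i ⋖ j) (hb : b i = b j) : pfaffianMultilinear ι f b = 0 := by
  change pfaffian _ = 0
  rw [pfaffian_eq_sum]
  have hzero : ∀ π ∈ pairings ι, π i = j →
      ∏ k ∈ univ.filter (fun k => k < π k), Matrix.of (fun i j => f (b i) (b j)) k (π k) = 0 := by
    intro π hπ h
    refine prod_eq_zero (i := i) (by simp [h, hij.1]) ?_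
    rw [Matrix.of_apply, h, hb]; exact hf _
  refine sum_involution (fun π _ => conjSwap i j π) (fun π hπ => ?_) (fun π hπ h0 h => ?_)
    (fun π hπ => conjSwap_mem hπ) (fun π hπ => conjSwap_conjSwap i j π)
  · by_cases hne : π i = j
    · have h' : conjSwap i j π i = j := by
        obtain ⟨h1, h2⟩ := mem_pairings.1 hπ
        rw [conjSwap_apply, Equiv.swap_apply_left, ← hne, h1, hne, Equiv.swap_apply_left]
      rw [hzero π hπ hne, hzero _ (conjSwap_mem hπ) h']; simp
    · rw [neg_one_pow_card_crossings_conjSwap hij hπ hne]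
      simp only [Matrix.of_apply]
      rw [prod_conjSwap f hij hπ hne hb]; ring
  · obtain ⟨h1, h2⟩ := mem_pairings.1 hπ
    by_cases hne : π i = j
    · exact h0 (by rw [hzero π hπ hne, mul_zero])
    · have := congrArg (fun σ => σ i) h
      simp only [conjSwap_apply, Equiv.swap_apply_left] at this
      rw [Equiv.swap_apply_of_ne_of_ne (fun h => hne (by rw [← h, h1])) (h2 j)] at this
      exact hij.1.ne (π.injective this).symm

theorem pfaffianMultilinear_swap_of_covBy {f : V →ₗ[R] V →ₗ[R] R} (hf : f.IsAlt) (b : ι → V)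
    {i j : ι} (hij : i ⋖ j) :
    pfaffianMultilinear ι f (b ∘ Equiv.swap i j) = -pfaffianMultilinear ι f b := by
  set F := pfaffianMultilinear ι f
  have hne := hij.1.ne
  have key : ∀ x y, F (Function.update (Function.update b i x) j y) +
      F (Function.update (Function.update b i y) j x) = 0 := by
    intro x y
    have h0 : ∀ z, F (Function.update (Function.update b i z) j z) = 0 := fun z =>
      pfaffianMultilinear_eq_zero_of_covBy hf hij (by simp [Function.update_of_ne hne])
    have h := h0 (x + y)
    rw [F.map_update_add, Function.update_comm hne, Function.update_comm hne,
      F.map_update_add, F.map_update_add] at h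
    simp only [Function.update_comm hne.symm] at h
    rw [h0, h0] at h
    rw [← h]; abel
  have h := key (b i) (b j)
  have e1 : Function.update (Function.update b i (b i)) j (b j) = b := by simp
  have e2 : Function.update (Function.update b i (b j)) j (b i) = b ∘ Equiv.swap i j := by
    ext x
    by_cases h1 : x = i
    · subst h1; simp [Function.update_of_ne hne]
    · by_cases h2 : x = j
      · subst h2; simp
      · simp [Function.update_of_ne, h1, h2, Equiv.swap_apply_of_ne_of_ne h1 h2]
  rw [e1, e2] at h
  exact eq_neg_of_add_eq_zero_right h

/-- Induction on the number of indices strictly between `i` and `j`: an adjacent transposition, at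
the cost of a sign, brings the two equal vectors closer. -/
theorem pfaffianMultilinear_eq_zero {f : V →ₗ[R] V →ₗ[R] R} (hf : f.IsAlt) :
    ∀ (m : ℕ) (i j : ι) (b : ι → V), i < j → (univ.filter fun x => i < x ∧ x < j).card ≤ m → b i = b j →
      pfaffianMultilinear ι f b = 0 := by
  intro m
  induction m with
  | zero =>
    intro i j b hij hm hb
    refine pfaffianMultilinear_eq_zero_of_covBy hf ⟨hij, fun c h1 h2 => ?_⟩ hb
    have : c ∈ univ.filter fun x => i < x ∧ x < j := by simp [h1, h2]
    rw [Nat.le_zero, card_eq_zero] at hm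
    rw [hm] at this
    exact notMem_empty _ this
  | succ m ih =>
    intro i j b hij hm hb
    by_cases hc : i ⋖ j
    · exact pfaffianMultilinear_eq_zero_of_covBy hf hc hb
    · obtain ⟨x, hix, hxj⟩ := exists_le_covBy_of_lt hij
      have hix' : i < x := lt_of_le_of_ne hix (by rintro rfl; exact hc hxj)
      have h := ih i x (b ∘ Equiv.swap x j) hix' ?_ ?_
      · rw [pfaffianMultilinear_swap_of_covBy hf b hxj, neg_eq_zero] at h
        exact h
      · have : (univ.filter fun y => i < y ∧ y < x) ⊂ univ.filter fun y => i < y ∧ y < j := by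
          rw [ssubset_iff_of_subset]
          · exact ⟨x, by simp [hix', hxj.1], by simp⟩
          · intro y hy
            simp only [mem_filter, mem_univ, true_and] at hy ⊢
            exact ⟨hy.1, hy.2.trans hxj.1⟩
        have := card_lt_card this
        omega
      · simp [Equiv.swap_apply_of_ne_of_ne hix'.ne hij.ne, hb]

/-- The Pfaffian of the Gram matrix with respect to an alternating form is alternating. -/
def pfaffianAlternating (ι : Type*) [Fintype ι] [LinearOrder ι] (f : V →ₗ[R] V →ₗ[R] R)
    (hf : f.IsAlt) : V [⋀^ι]→ₗ[R] R where
  __ := pfaffianMultilinear ι f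
  map_eq_zero_of_eq' b i j hb hij := by
    rcases lt_or_gt_of_ne hij with h | h
    · exact pfaffianMultilinear_eq_zero hf _ i j b h le_rfl hb
    · exact pfaffianMultilinear_eq_zero hf _ j i b h le_rfl hb.symm

theorem isAlt_toLinearMap₂' {A : Matrix ι ι R} (hA : Aᵀ = -A) (hd : ∀ i, A i i = 0) :
    LinearMap.IsAlt (Matrix.toLinearMap₂' R A : (ι → R) →ₗ[R] (ι → R) →ₗ[R] R) := by
  intro x
  have hA' : ∀ i j, A j i = -A i j := fun i j => congrFun (congrFun hA i) j
  rw [Matrix.toLinearMap₂'_apply']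
  simp only [dotProduct, mulVec, mul_sum]
  rw [← sum_product']
  refine sum_involution (fun p _ => p.swap) (fun p _ => ?_) (fun p _ h0 h => h0 ?_) (by simp)
    (by simp)
  · simp only [Prod.fst_swap, Prod.snd_swap]
    rw [hA' p.1 p.2]; ring
  · have : p.1 = p.2 := (congrArg Prod.snd h)
    rw [this, hd]; ring

/-- The entries of `B * A * Bᵀ` are the products of the rows of `B` for the form `A`, so the left
side is an alternating function of these rows, hence a multiple of the determinant; `B = 1` gives
the factor. -/
theorem pfaffian_mul_mul_transpose {A : Matrix ι ι R} (hA : Aᵀ = -A) (hd : ∀ i, A i i = 0)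
    (B : Matrix ι ι R) : pfaffian (B * A * Bᵀ) = B.det * pfaffian A := by
  have hf := isAlt_toLinearMap₂' hA hd
  have h := AlternatingMap.eq_smul_basis_det (Pi.basisFun R ι) (pfaffianAlternating ι _ hf)
  have h1 : ∀ B : Matrix ι ι R, pfaffianAlternating ι _ hf (fun i => B i) =
      pfaffian (B * A * Bᵀ) := by
    intro B
    change pfaffian _ = _
    congr 1
    ext i j
    rw [Matrix.of_apply, Matrix.toLinearMap₂'_apply', Matrix.mul_assoc, Matrix.mul_apply']
    rfl
  rw [← h1, h, AlternatingMap.smul_apply]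
  have h2 : (⇑(Pi.basisFun R ι) : ι → ι → R) = fun i => (1 : Matrix ι ι R) i := by
    ext i j; simp [Matrix.one_apply, Pi.single_apply, eq_comm]
  rw [h2, h1, Pi.basisFun_det_apply, smul_eq_mul, mul_comm]
  simp
  rfl

end Pfaffian

/-! ### Symplectic bases, and the square of the Pfaffian. -/

section Darboux

open Finset Matrix

variable {K V : Type*} [Field K] [AddCommGroup V] [Module K V]

/-- `e` and `g` are the two halves of a standard symplectic family. -/
structure IsSymplecticFamily (f : V →ₗ[K] V →ₗ[K] K) {k : ℕ} (e g : Fin k → V) : Prop where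
  left : ∀ i j, f (e i) (e j) = 0
  right : ∀ i j, f (g i) (g j) = 0
  cross : ∀ i j, f (e i) (g j) = if i = j then 1 else 0

theorem IsSymplecticFamily.le_finrank [FiniteDimensional K V] {f : V →ₗ[K] V →ₗ[K] K} {k : ℕ}
    {e g : Fin k → V} (h : IsSymplecticFamily f e g) : k ≤ Module.finrank K V := by
  have : LinearIndependent K e := by
    rw [Fintype.linearIndependent_iff]
    intro c hc j
    have := congrArg (fun x => f x (g j)) hc
    simpa [h.cross] using this
  simpa using this.fintype_card_le_finrank

/-- In the orthogonal of a symplectic family, two vectors with product one extend the family. -/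
theorem IsSymplecticFamily.cons {f : V →ₗ[K] V →ₗ[K] K} (hf : f.IsAlt) {k : ℕ}
    {e g : Fin k → V} (h : IsSymplecticFamily f e g) {x y : V} (hxy : f x y = 1)
    (hx : ∀ i, f x (e i) = 0 ∧ f x (g i) = 0) (hy : ∀ i, f y (e i) = 0 ∧ f y (g i) = 0) :
    IsSymplecticFamily f (Fin.cons x e : Fin (k + 1) → V) (Fin.cons y g : Fin (k + 1) → V) := by
  have hsymm : ∀ u v, f u v = -f v u := fun u v => by rw [hf.neg]
  refine ⟨fun i j => ?_, fun i j => ?_, fun i j => ?_⟩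
  · refine Fin.cases ?_ (fun i => ?_) i <;> refine Fin.cases ?_ (fun j => ?_) j
    · exact hf x
    · simpa using (hx j).1
    · simpa [hsymm (e i)] using (hx i).1
    · simpa using h.left i j
  · refine Fin.cases ?_ (fun i => ?_) i <;> refine Fin.cases ?_ (fun j => ?_) j
    · exact hf y
    · simpa using (hy j).2
    · simpa [hsymm (g i)] using (hy i).2
    · simpa using h.right i j
  · refine Fin.cases ?_ (fun i => ?_) i <;> refine Fin.cases ?_ (fun j => ?_) j
    · simpa using hxy
    · simpa [(Fin.succ_ne_zero j).symm] using (hx j).2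
    · simpa [hsymm (e i), Fin.succ_ne_zero] using (hy i).1
    · simpa using h.cross i j

/-- The component of a vector which is orthogonal to a symplectic family. -/
theorem IsSymplecticFamily.orthogonal {f : V →ₗ[K] V →ₗ[K] K} (hf : f.IsAlt) {k : ℕ}
    {e g : Fin k → V} (h : IsSymplecticFamily f e g) (x : V) (j : Fin k) :
    f (x - (∑ i, f x (g i) • e i - ∑ i, f x (e i) • g i)) (e j) = 0 ∧
      f (x - (∑ i, f x (g i) • e i - ∑ i, f x (e i) • g i)) (g j) = 0 := by
  have hge : ∀ i j, f (g i) (e j) = -if j = i then 1 else 0 := fun i j => by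
    rw [← h.cross, hf.neg]
  constructor
  · simp [h.left, hge]
  · simp [h.right, h.cross]

theorem exists_symplecticFamily [FiniteDimensional K V] {f : V →ₗ[K] V →ₗ[K] K} (hf : f.IsAlt)
    (hn : ∀ x, (∀ y, f x y = 0) → x = 0) :
    ∃ (k : ℕ) (e g : Fin k → V), IsSymplecticFamily f e g ∧
      ∀ x, x = ∑ i, f x (g i) • e i - ∑ i, f x (e i) • g i := by
  classical
  let P : ℕ → Prop := fun k => ∃ e g : Fin k → V, IsSymplecticFamily f e g
  have hP0 : P 0 := ⟨0, 0, ⟨fun i => i.elim0, fun i => i.elim0, fun i => i.elim0⟩⟩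
  -- A family of maximal length spans: a nonzero remainder orthogonal to it pairs nontrivially with
  -- some vector, and after projection and rescaling the two would extend the family.
  obtain ⟨e, g, h⟩ : P (Nat.findGreatest P (Module.finrank K V)) :=
    Nat.findGreatest_spec (Nat.zero_le _) hP0
  refine ⟨_, e, g, h, fun x => ?_⟩
  by_contra hx
  have hx' := sub_ne_zero.2 hx
  set x' := x - (∑ i, f x (g i) • e i - ∑ i, f x (e i) • g i) with hx'def
  have hox : ∀ j, f x' (e j) = 0 ∧ f x' (g j) = 0 := h.orthogonal hf x
  obtain ⟨y, hy⟩ : ∃ y, f x' y ≠ 0 := by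
    by_contra hcon
    push Not at hcon
    exact hx' (hn _ hcon)
  set y' := y - (∑ i, f y (g i) • e i - ∑ i, f y (e i) • g i) with hy'def
  have hoy : ∀ j, f y' (e j) = 0 ∧ f y' (g j) = 0 := h.orthogonal hf y
  have hxy : f x' y' = f x' y := by
    rw [hy'def]
    simp [hox]
  have hfam := h.cons hf (x := x') (y := (f x' y)⁻¹ • y')
    (by rw [map_smul, hxy, smul_eq_mul, inv_mul_cancel₀ hy]) hox
    (fun i => by simp [hoy])
  have := Nat.le_findGreatest (P := P) hfam.le_finrank ⟨_, _, hfam⟩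
  omega

variable {ι : Type*} [Fintype ι] [LinearOrder ι]

theorem pfaffian_J_sq {k : ℕ} (σ : ι ≃ Fin k ⊕ Fin k) :
    (pfaffian ((J (Fin k) K).submatrix σ σ)) ^ 2 = 1 := by
  have hJ : ∀ x y, y ≠ Sum.swap x → J (Fin k) K x y = 0 := by
    rintro (x | x) (y | y) h <;> simp_all [J, eq_comm]
  have hJ' : ∀ x, J (Fin k) K x (Sum.swap x) ^ 2 = 1 := by
    rintro (x | x) <;> simp [J]
  -- Each row of `J` has a single nonzero entry, so only this pairing contributes.
  let π₀ : Equiv.Perm ι := (σ.trans (Equiv.sumComm _ _)).trans σ.symm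
  have hπ₀ : ∀ x, π₀ x = σ.symm (Sum.swap (σ x)) := fun x => rfl
  have hmem : π₀ ∈ pairings ι := by
    refine mem_pairings.2 ⟨fun x => by simp [hπ₀], fun x h => ?_⟩
    rw [hπ₀, Equiv.symm_apply_eq] at h
    rcases hx : σ x with y | y <;> simp [hx] at h
  rw [pfaffian_eq_sum, sum_eq_single_of_mem π₀ hmem]
  · rw [mul_pow, ← pow_mul, mul_comm _ 2, pow_mul, neg_one_sq, one_pow, one_mul, ← prod_pow]
    refine prod_eq_one fun i _ => ?_
    rw [submatrix_apply, hπ₀, Equiv.apply_symm_apply, hJ']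
  · intro π hπ hne
    obtain ⟨h1, h2⟩ := mem_pairings.1 hπ
    obtain ⟨i, hi⟩ : ∃ i, π i ≠ π₀ i := by
      by_contra h
      push Not at h
      exact hne (Equiv.ext h)
    have key : ∀ i, π i ≠ π₀ i → i < π i →
        ∏ i ∈ univ.filter (fun i => i < π i), (J (Fin k) K).submatrix σ σ i (π i) = 0 := by
      intro i hi hlt
      refine prod_eq_zero (i := i) (by simp [hlt]) (hJ _ _ fun h => hi ?_)
      rw [hπ₀, ← h, Equiv.symm_apply_apply]
    rcases lt_or_gt_of_ne (h2 i) with h | h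
    · rw [key (π i) (fun h' => hi ?_) (by rwa [h1]), mul_zero]
      rw [h1] at h'
      rw [← (mem_pairings.1 hmem).1 (π i), ← h']
    · rw [key i hi h, mul_zero]

/-- The square of the Pfaffian is the determinant, up to sign. -/
theorem pfaffian_sq_eq_or {A : Matrix ι ι K} (hA : Aᵀ = -A) (hd : ∀ i, A i i = 0) :
    pfaffian A ^ 2 = A.det ∨ pfaffian A ^ 2 = -A.det := by
  by_cases hdet : A.det = 0
  · left
    obtain ⟨v, hv, hAv⟩ := exists_mulVec_eq_zero_iff.2 hdet
    obtain ⟨i, hi⟩ : ∃ i, v i ≠ 0 := by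
      by_contra h; push Not at h; exact hv (funext h)
    -- Singular case: with a kernel vector as row `i` of the transition matrix, the congruent matrix
    -- has zero row and column `i`, so its Pfaffian vanishes, while the transition matrix has
    -- determinant `v i ≠ 0`.
    have h := pfaffian_mul_mul_transpose hA hd ((1 : Matrix ι ι K).updateRow i v)
    have hzero : pfaffian ((1 : Matrix ι ι K).updateRow i v * A *
        ((1 : Matrix ι ι K).updateRow i v)ᵀ) = 0 := by
      rw [pfaffian_eq_sum]
      refine sum_eq_zero fun π hπ => ?_
      obtain ⟨h1, h2⟩ := mem_pairings.1 hπ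
      have hcol : ∀ j, ((1 : Matrix ι ι K).updateRow i v * A *
          ((1 : Matrix ι ι K).updateRow i v)ᵀ) j i = 0 := by
        intro j
        rw [Matrix.mul_assoc, Matrix.mul_apply]
        refine sum_eq_zero fun k _ => ?_
        have : (A * ((1 : Matrix ι ι K).updateRow i v)ᵀ) k i = (A *ᵥ v) k := by
          simp [Matrix.mul_apply, mulVec, dotProduct]
        rw [this, hAv, Pi.zero_apply, mul_zero]
      have hrow : ∀ j, ((1 : Matrix ι ι K).updateRow i v * A *
          ((1 : Matrix ι ι K).updateRow i v)ᵀ) i j = 0 := by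
        intro j
        rw [Matrix.mul_apply]
        refine sum_eq_zero fun k _ => ?_
        have : ((1 : Matrix ι ι K).updateRow i v * A) i k = (v ᵥ* A) k := by
          simp [Matrix.mul_apply, vecMul, dotProduct]
        rw [this, ← mulVec_transpose, hA, neg_mulVec, hAv]
        simp
      rcases lt_or_gt_of_ne (h2 i) with h | h
      · rw [prod_eq_zero (i := π i) (by simp [h1, h]) (by rw [h1]; exact hcol _), mul_zero]
      · rw [prod_eq_zero (i := i) (by simp [h]) (hrow (π i)), mul_zero]
    have hdet1 : ((1 : Matrix ι ι K).updateRow i v).det = v i := by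
      have := det_updateRow_sum (1 : Matrix ι ι K) i v
      simp only [det_one, smul_eq_mul, mul_one] at this
      rw [← this]
      congr 2
      ext j
      simp [Matrix.one_apply]
    rw [hzero, hdet1] at h
    rcases mul_eq_zero.1 h.symm with h | h
    · exact absurd h hi
    · rw [h, hdet]; simp
  · have hf := isAlt_toLinearMap₂' hA hd
    obtain ⟨k, e, g, h, hspan⟩ := exists_symplecticFamily hf (by
      intro x hx
      by_contra hne
      refine hdet (exists_vecMul_eq_zero_iff.1 ⟨x, hne, ?_⟩)
      ext j
      have := hx (Pi.single j 1)
      rw [Matrix.toLinearMap₂'_apply', dotProduct_mulVec] at this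
      simpa using this)
    -- The half `g` comes first because `J` has `-1` in its upper right block.
    let Q : Matrix (Fin k ⊕ Fin k) ι K := Matrix.of (Sum.elim g e)
    have hQ : Q * A * Qᵀ = J (Fin k) K := by
      ext x y
      have : (Q * A * Qᵀ) x y = Matrix.toLinearMap₂' K A (Q x) (Q y) := by
        rw [Matrix.toLinearMap₂'_apply', Matrix.mul_assoc, Matrix.mul_apply']
        rfl
      rw [this]
      rcases x with x | x <;> rcases y with y | y
      · change Matrix.toLinearMap₂' K A (g x) (g y) = _
        rw [h.right]; simp [J]
      · change Matrix.toLinearMap₂' K A (g x) (e y) = _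
        rw [← hf.neg, h.cross]; simp [J, Matrix.one_apply, eq_comm]
      · change Matrix.toLinearMap₂' K A (e x) (g y) = _
        rw [h.cross]; simp [J, Matrix.one_apply]
      · change Matrix.toLinearMap₂' K A (e x) (e y) = _
        rw [h.left]; simp [J]
    have hright : Q * (A * Qᵀ * (-J (Fin k) K)) = 1 := by
      rw [← Matrix.mul_assoc, ← Matrix.mul_assoc, hQ, Matrix.mul_neg, J_squared, neg_neg]
    let X : Matrix ι (Fin k ⊕ Fin k) K := Matrix.of fun i =>
      Sum.elim (fun l => -Matrix.toLinearMap₂' K A (Pi.single i (1 : K) : ι → K) (e l))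
        (fun l => Matrix.toLinearMap₂' K A (Pi.single i (1 : K) : ι → K) (g l))
    have hleft : X * Q = 1 := by
      ext i j
      have := congrFun (hspan (Pi.single i (1 : K) : ι → K)) j
      rw [Matrix.mul_apply, Fintype.sum_sum_type]
      have h1 : (1 : Matrix ι ι K) i j = (Pi.single i 1 : ι → K) j := by
        simp [Matrix.one_apply, Pi.single_apply, eq_comm]
      rw [h1, this]
      simp only [X, Q, of_apply, Sum.elim_inl, Sum.elim_inr, Pi.sub_apply, Finset.sum_apply,
        Pi.smul_apply, smul_eq_mul, neg_mul, sum_neg_distrib]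
      ring
    -- `Q` has inverses on both sides, so comparing ranks shows that it is square; only then does
    -- its determinant make sense.
    have hcard : Fintype.card ι = Fintype.card (Fin k ⊕ Fin k) := by
      refine le_antisymm ?_ ?_
      · have h1 := rank_mul_le_left X Q
        rw [hleft, rank_one] at h1
        exact h1.trans (rank_le_card_width _)
      · have h1 := rank_mul_le_left Q (A * Qᵀ * (-J (Fin k) K))
        rw [hright, rank_one] at h1
        exact h1.trans (rank_le_card_width _)
    let σ := Fintype.equivOfCardEq hcard
    have hB : Q.submatrix σ id * A * (Q.submatrix σ id)ᵀ = (J (Fin k) K).submatrix σ σ := by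
      rw [← hQ]
      ext i j
      simp [Matrix.mul_apply]
    have hpf := pfaffian_mul_mul_transpose hA hd (Q.submatrix σ id)
    have hdet2 := congrArg det hB
    rw [hB] at hpf
    rw [det_mul, det_mul, det_transpose, det_submatrix_equiv_self] at hdet2
    have hpf2 := pfaffian_J_sq (K := K) σ
    rw [hpf] at hpf2
    have hJ2 := J_det_mul_J_det (Fin k) K
    have hJ3 : (J (Fin k) K).det = 1 ∨ (J (Fin k) K).det = -1 := mul_self_eq_one_iff.1 hJ2
    set b := (Q.submatrix σ id).det
    have hb : b ^ 2 ≠ 0 := by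
      intro h0
      rw [mul_pow, h0, zero_mul] at hpf2
      exact zero_ne_one hpf2
    rcases hJ3 with h3 | h3
    · left
      refine mul_left_cancel₀ hb ?_
      rw [← mul_pow, hpf2, ← h3, ← hdet2]; ring
    · right
      refine mul_left_cancel₀ hb ?_
      rw [← mul_pow, hpf2, mul_neg, eq_neg_iff_add_eq_zero]
      have : b ^ 2 * A.det = -1 := by rw [← h3, ← hdet2]; ring
      rw [this]; ring

theorem map_pfaffian {R S : Type*} [CommRing R] [CommRing S] (φ : R →+* S) (A : Matrix ι ι R) :
    pfaffian (A.map φ) = φ (pfaffian A) := by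
  simp [pfaffian_eq_sum]

/-- Over `ℚ` the square equals the determinant up to sign, and a square is nonnegative. -/
theorem pfaffian_sq_eq_abs_det {A : Matrix ι ι ℤ} (hA : Aᵀ = -A) : pfaffian A ^ 2 = |A.det| := by
  have hd : ∀ i, A i i = 0 := fun i => by
    have := congrFun (congrFun hA i) i
    simp only [transpose_apply, neg_apply] at this
    omega
  have h := pfaffian_sq_eq_or (A := A.map (Int.castRingHom ℚ))
    (by rw [← transpose_map, hA]; ext; simp) (fun i => by simp [hd])
  rw [map_pfaffian, ← RingHom.mapMatrix_apply, ← RingHom.map_det] at h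
  have h' : pfaffian A ^ 2 = A.det ∨ pfaffian A ^ 2 = -A.det := by
    rcases h with h | h
    · left; simp only [eq_intCast] at h; exact_mod_cast h
    · right; simp only [eq_intCast] at h; exact_mod_cast h
  have hsq := sq_nonneg (pfaffian A)
  rcases h' with h' | h'
  · rw [h', abs_of_nonneg (h' ▸ hsq)]
  · rw [h', abs_of_nonpos (by linarith)]

end Darboux

/-! ### The determinant of the oscillation form. -/

section Oscillation

open Finset Matrix

/-- An integer matrix whose reductions modulo all primes are injective is unimodular. -/
theorem abs_det_eq_one_of_forall_zmod {ι : Type*} [Fintype ι] [DecidableEq ι] (A : Matrix ι ι ℤ)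
    (h : ∀ p : ℕ, p.Prime → ∀ x : ι → ZMod p, A.map (Int.cast : ℤ → ZMod p) *ᵥ x = 0 → x = 0) :
    |A.det| = 1 := by
  rw [Int.abs_eq_natAbs]
  norm_cast
  rw [Nat.eq_one_iff_not_exists_prime_dvd]
  intro p hp hdvd
  have : Fact p.Prime := ⟨hp⟩
  have h0 : (A.map (Int.castRingHom (ZMod p))).det = 0 := by
    rw [← RingHom.mapMatrix_apply, ← RingHom.map_det, eq_intCast, ZMod.intCast_zmod_eq_zero_iff_dvd]
    exact Int.natCast_dvd.2 hdvd
  obtain ⟨x, hx, hAx⟩ := exists_mulVec_eq_zero_iff.2 h0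
  exact hx (h p hp x hAx)

/-- The matrix of a permutation, acting on functions by composition. -/
def permMat {D : Type*} [DecidableEq D] (σ : Equiv.Perm D) : Matrix D D ℤ :=
  Matrix.of fun c d => if σ c = d then 1 else 0

theorem permMat_mul_apply {D X : Type*} [Fintype D] [DecidableEq D] (σ : Equiv.Perm D)
    (A : Matrix D X ℤ) (c : D) (x : X) : (permMat σ * A) c x = A (σ c) x := by
  simp [permMat, Matrix.mul_apply]

section Faces

variable {D : Type*} [Fintype D] [DecidableEq D]

/-- Modulo a prime, let `x` be in the kernel. Permutations preserve the sum of the coordinates, so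
adding all the equations leaves `x b = 0`. Then `x ∘ ρ = x ∘ α`, so `x` is invariant under the
transitive `ρ * α` and equals the constant `x b`. -/
theorem abs_det_of_sameCycle (ρ α : Equiv.Perm D) (hα : ∀ c, α (α c) = c)
    (h : ∀ c d, (ρ * α).SameCycle c d) (a b : D) :
    |(permMat ρ - permMat α + Matrix.single a b 1).det| = 1 := by
  refine abs_det_eq_one_of_forall_zmod _ fun p hp x hx => ?_
  have hc : ∀ c, x (ρ c) - x (α c) + (if c = a then x b else 0) = 0 := by
    intro c
    have := congrFun hx c
    simp only [mulVec, dotProduct, map_apply, permMat, Matrix.add_apply, Matrix.sub_apply, of_apply,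
      Matrix.single_apply, Int.cast_add, Int.cast_sub, Int.cast_ite, Int.cast_one, Int.cast_zero,
      add_mul, sub_mul, ite_mul, one_mul, zero_mul, sum_add_distrib, sum_sub_distrib,
      Finset.sum_ite_eq, mem_univ, if_true, Pi.zero_apply] at this
    refine Eq.trans ?_ this
    congr 1
    by_cases hca : c = a
    · subst hca; simp
    · simp [hca, Ne.symm hca]
  have hb : x b = 0 := by
    have : ∑ c, (x (ρ c) - x (α c) + (if c = a then x b else 0)) = 0 :=
      sum_eq_zero fun c _ => hc c
    rw [sum_add_distrib, sum_sub_distrib, Equiv.sum_comp ρ x, Equiv.sum_comp α x] at this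
    simpa using this
  have hinv : ∀ c, x ((ρ * α) c) = x c := fun c => by
    have := hc (α c)
    rw [hb, ite_self, add_zero, hα, sub_eq_zero] at this
    exact this
  funext c
  obtain ⟨k, hk⟩ := h b c
  have hz : ∀ k : ℤ, ∀ c, x (((ρ * α) ^ k) c) = x c := by
    intro k
    induction k using Int.induction_on with
    | zero => simp
    | succ i ih => intro c; rw [_root_.zpow_add_one, Equiv.Perm.mul_apply, ih, hinv]
    | pred i ih =>
      intro c
      rw [_root_.zpow_sub_one, Equiv.Perm.mul_apply, ih, ← hinv]
      simp
  rw [← hk, hz, hb, Pi.zero_apply]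

/-- The indicator of the corners outside the cycle of `b` lies in the kernel. -/
theorem det_of_not_sameCycle (ρ α : Equiv.Perm D) (hα : ∀ c, α (α c) = c) (a b : D)
    (h : ¬ ∀ c d, (ρ * α).SameCycle c d) :
    (permMat ρ - permMat α + Matrix.single a b 1).det = 0 := by
  classical
  obtain ⟨z, hz⟩ : ∃ z, ¬ (ρ * α).SameCycle b z := by
    by_contra hcon
    push Not at hcon
    exact h fun c d => (hcon c).symm.trans (hcon d)
  refine exists_mulVec_eq_zero_iff.1
    ⟨fun d => if (ρ * α).SameCycle b d then 0 else 1, fun h0 => ?_, ?_⟩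
  · have := congrFun h0 z
    simp [hz] at this
  · funext c
    have h1 : (ρ * α).SameCycle b (ρ c) ↔ (ρ * α).SameCycle b (α c) := by
      have := Equiv.Perm.sameCycle_apply_right (f := ρ * α) (x := b) (y := α c)
      rwa [Equiv.Perm.mul_apply, hα] at this
    simp only [mulVec, dotProduct, permMat, Matrix.add_apply, Matrix.sub_apply, of_apply,
      Matrix.single_apply, add_mul, sub_mul, ite_mul, one_mul, zero_mul, sum_add_distrib,
      sum_sub_distrib, Finset.sum_ite_eq, mem_univ, if_true, Pi.zero_apply, h1, sub_self, zero_add]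
    refine sum_eq_zero fun d _ => ?_
    split_ifs with h2 h3
    · rfl
    · exact absurd (h2.2 ▸ Equiv.Perm.SameCycle.refl _ _) h3
    · rfl

end Faces

variable {n : ℕ} {S : Type*} [Fintype S] [DecidableEq S]

/-- The rotation of the corners around the vertices. -/
def cornerRot (n : ℕ) : Equiv.Perm (Fin n × Fin 4) :=
  Equiv.prodCongr (Equiv.refl (Fin n)) (Equiv.addRight 1)

/-- The sign matrix of the order of the corners around each vertex. -/
def orderMat (n : ℕ) : Matrix (Fin n × Fin 4) (Fin n × Fin 4) ℤ :=
  Matrix.of fun c d => if c.1 = d.1 ∧ c.2 ≠ d.2 then Phi4Graph.omega c.2 d.2 else 0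

/-- Each vertex sum, placed at the last corner of the vertex. -/
def lastSum (n : ℕ) : Matrix (Fin n × Fin 4) (Fin n × Fin 4) ℤ :=
  Matrix.of fun c d => if c.1 = d.1 ∧ c.2 = 3 then 1 else 0

/-- A step of the first corner changes `ω(i, j)` by `-1` on reaching `j` and by `-1` on leaving it;
the return from the last corner to the first adds `2`. -/
theorem rot_sub_one_mul_orderMat :
    (permMat (cornerRot n) - 1) * orderMat n = -(permMat (cornerRot n) + 1) + 2 • lastSum n := by
  ext ⟨v, i⟩ ⟨w, j⟩
  rw [Matrix.sub_mul, Matrix.sub_apply, permMat_mul_apply, Matrix.one_mul]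
  by_cases h : v = w
  · subst h
    fin_cases i <;> fin_cases j <;>
      simp [cornerRot, orderMat, permMat, lastSum, Phi4Graph.omega]
  · simp [cornerRot, orderMat, permMat, lastSum, h]

/-- The matrix `1 - 1 wᵗ`, where `w` is the indicator of the corner `b`. -/
def subAt (b : Fin n × Fin 4) : Matrix (Fin n × Fin 4) (Fin n × Fin 4) ℤ :=
  Matrix.of fun c d => (if c = d then 1 else 0) - if d = b then 1 else 0

/-- The matrix `Z` subtracts from a vector the constant equal to its value at `(r, 0)`. The maps `P
- 1` and `Kᵀ` kill constants, so `Z` does not affect them, whereas `E * Z = 0`. A column operation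
with `Z * (1 + orderMat n) * K` therefore meets only `P - 1`, reduces the line block to twice the
identity, and leaves the Schur complement `P - 1 + E + K * Kᵀ`. -/
theorem det_cornerForm (r : Fin n) (α : Equiv.Perm (Fin n × Fin 4))
    (K : Matrix (Fin n × Fin 4) S ℤ) (h1 : Kᵀ * K = 2 • (1 : Matrix S S ℤ))
    (h2 : K * Kᵀ = 1 - permMat α) (h3 : ∀ l, ∑ c, K c l = 0) :
    (fromBlocks (permMat (cornerRot n) - 1 + Matrix.single (r, 3) (r, 0) 1)
      (-(2 • (lastSum n * K))) Kᵀ (-(Kᵀ * orderMat n * K))).det =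
    2 ^ Fintype.card S *
      (permMat (cornerRot n) - permMat α + Matrix.single (r, 3) (r, 0) 1).det := by
  set P := permMat (cornerRot n)
  set E : Matrix (Fin n × Fin 4) (Fin n × Fin 4) ℤ := Matrix.single (r, 3) (r, 0) 1 with hE
  set Z := subAt (r, (0 : Fin 4))
  have hPZ : (P - 1) * Z = P - 1 := by
    ext c d
    rw [Matrix.sub_mul, Matrix.sub_apply, permMat_mul_apply, Matrix.one_mul]
    simp [Z, subAt, P, permMat, Matrix.one_apply]
  have hEZ : E * Z = 0 := by
    ext c d
    rw [Matrix.mul_apply]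
    refine sum_eq_zero fun x _ => ?_
    rw [hE, Matrix.single_apply]
    split_ifs with h
    · rw [← h.2]; simp [Z, subAt, eq_comm]
    · simp
  have hKZ : Kᵀ * Z = Kᵀ := by
    ext l d
    rw [Matrix.mul_apply]
    simp [Z, subAt, mul_sub, h3]
  have key : fromBlocks (P - 1 + E) (-(2 • (lastSum n * K))) Kᵀ (-(Kᵀ * orderMat n * K)) *
      fromBlocks 1 (Z * (1 + orderMat n) * K) 0 1 =
      fromBlocks (P - 1 + E) (-K) Kᵀ 1 * fromBlocks 1 0 0 (2 • (1 : Matrix S S ℤ)) := by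
    rw [fromBlocks_multiply, fromBlocks_multiply]
    congr 1
    · simp
    · have : (P - 1 + E) * (Z * (1 + orderMat n) * K) = -(2 • K) + 2 • (lastSum n * K) := by
        rw [← Matrix.mul_assoc, ← Matrix.mul_assoc, Matrix.add_mul, hPZ, hEZ, add_zero,
          Matrix.mul_add, rot_sub_one_mul_orderMat, Matrix.mul_one]
        rw [show P - 1 + (-(P + 1) + 2 • lastSum n) = -(2 • 1) + 2 • lastSum n by
          simp only [two_smul]; abel]
        rw [Matrix.add_mul, Matrix.neg_mul, Matrix.smul_mul, Matrix.smul_mul, Matrix.one_mul]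
      rw [this, Matrix.mul_zero, Matrix.mul_smul, Matrix.mul_one, Matrix.mul_one, smul_neg]
      abel
    · simp
    · rw [← Matrix.mul_assoc, ← Matrix.mul_assoc, hKZ, Matrix.mul_add, Matrix.add_mul,
        Matrix.mul_one, h1]
      simp
  have hdet := congrArg det key
  rw [det_mul, det_mul, det_fromBlocks_zero₂₁, det_fromBlocks_one₂₂, det_fromBlocks_zero₂₁,
    Matrix.neg_mul, h2] at hdet
  simp only [det_one, mul_one, one_mul, det_smul_of_tower] at hdet
  rw [hdet, mul_comm]
  simp only [nsmul_eq_mul, mul_one]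
  congr 2
  abel

/-- Summation of rows: the row of the corner `(v, i + 1)` is the row of `(v, i)`, the row of `(v, 0)`
is the sum of the rows of `v`, and the row of `(r, 0)` is the sum of all the rows. -/
def rowSum (r : Fin n) : Matrix (Fin n × Fin 4) (Fin n × Fin 4) ℤ :=
  Matrix.of fun c d =>
    if c.2 = 0 then (if c.1 = r ∨ c.1 = d.1 then 1 else 0) else if cornerRot n d = c then 1 else 0

/-- Partial sums along each vertex. -/
def partialSum (n : ℕ) : Matrix (Fin n × Fin 4) (Fin n × Fin 4) ℤ :=
  Matrix.of fun c d => if c.1 = d.1 ∧ d.2 ≤ c.2 then 1 else 0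

theorem rowSum_mul_root {X : Type*} (r : Fin n) (A : Matrix (Fin n × Fin 4) X ℤ) (x : X) :
    (rowSum r * A) (r, 0) x = ∑ c, A c x := by
  simp [rowSum, Matrix.mul_apply]

theorem rowSum_mul_zero {X : Type*} {r v : Fin n} (hv : v ≠ r) (A : Matrix (Fin n × Fin 4) X ℤ)
    (x : X) : (rowSum r * A) (v, 0) x = ∑ i, A (v, i) x := by
  rw [Matrix.mul_apply, Fintype.sum_prod_type, Finset.sum_eq_single v]
  · simp [rowSum]
  · intro w _ hw
    simp [rowSum, hv, hw.symm]
  · simp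

theorem rowSum_mul_succ {X : Type*} (r v : Fin n) (i : Fin 4) (hi : i ≠ 0)
    (A : Matrix (Fin n × Fin 4) X ℤ) (x : X) :
    (rowSum r * A) (v, i) x = A (v, i - 1) x := by
  have : ∀ d : Fin n × Fin 4, cornerRot n d = (v, i) ↔ d = (v, i - 1) := by
    rintro ⟨w, j⟩
    simp [cornerRot, eq_sub_iff_add_eq]
  simp [rowSum, Matrix.mul_apply, hi, this]

theorem abs_det_rowSum (r : Fin n) : |(rowSum r).det| = 1 := by
  refine abs_det_eq_one_of_forall_zmod _ fun p hp x hx => ?_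
  have hc : ∀ c, ∑ d, ((rowSum r c d : ℤ) : ZMod p) * x d = 0 := fun c => congrFun hx c
  have h1 : ∀ v (i : Fin 4), i ≠ 0 → x (v, i - 1) = 0 := by
    intro v i hi
    have := hc (v, i)
    have h' : ∀ d : Fin n × Fin 4, cornerRot n d = (v, i) ↔ d = (v, i - 1) := by
      rintro ⟨w, j⟩
      simp [cornerRot, eq_sub_iff_add_eq]
    simpa [rowSum, hi, h'] using this
  have h012 : ∀ v, x (v, 0) = 0 ∧ x (v, 1) = 0 ∧ x (v, 2) = 0 := fun v =>
    ⟨h1 v 1 (by decide), h1 v 2 (by decide), h1 v 3 (by decide)⟩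
  have h3 : ∀ v, v ≠ r → x (v, 3) = 0 := by
    intro v hv
    have := hc (v, 0)
    simpa [rowSum, hv, Fintype.sum_prod_type, Fin.sum_univ_four, h012, ite_add_ite,
      ← Finset.sum_add_distrib] using this
  have h3r : x (r, 3) = 0 := by
    have := hc (r, 0)
    simp only [rowSum, of_apply, true_or, if_true, Int.cast_one, one_mul, Fintype.sum_prod_type,
      Fin.sum_univ_four, h012, zero_add] at this
    rwa [Finset.sum_eq_single r (fun v _ hv => h3 v hv) (by simp)] at this
  funext ⟨v, i⟩
  have hv3 : x (v, 3) = 0 := by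
    by_cases h : v = r
    · rw [h, h3r]
    · exact h3 v h
  fin_cases i
  · exact (h012 v).1
  · exact (h012 v).2.1
  · exact (h012 v).2.2
  · exact hv3

theorem abs_det_partialSum : |(partialSum n).det| = 1 := by
  refine abs_det_eq_one_of_forall_zmod _ fun p hp x hx => ?_
  have hc : ∀ c, ∑ d, ((partialSum n c d : ℤ) : ZMod p) * x d = 0 := fun c => congrFun hx c
  have h' : ∀ v i, ∑ j : Fin 4, (if j ≤ i then x (v, j) else 0) = 0 := by
    intro v i
    have := hc (v, i)
    rw [Fintype.sum_prod_type, Finset.sum_eq_single v] at this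
    · simpa [partialSum] using this
    · intro w _ hw
      simp [partialSum, hw.symm]
    · simp
  have h0 : ∀ v, x (v, 0) = 0 := fun v => by
    have := h' v 0
    simpa [Fin.sum_univ_four] using this
  have h1 : ∀ v, x (v, 1) = 0 := fun v => by
    have := h' v 1
    simpa [Fin.sum_univ_four, h0] using this
  have h2 : ∀ v, x (v, 2) = 0 := fun v => by
    have := h' v 2
    simpa [Fin.sum_univ_four, h0, h1] using this
  have h3 : ∀ v, x (v, 3) = 0 := fun v => by
    have := h' v 3
    simpa [Fin.sum_univ_four, h0, h1, h2, Fin.le_last] using this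
  funext ⟨v, i⟩
  fin_cases i
  · exact h0 v
  · exact h1 v
  · exact h2 v
  · exact h3 v

/-- The diagonal matrix which vanishes at the first corners of the vertices other than the root. -/
def offRoot (r : Fin n) : Matrix (Fin n × Fin 4) (Fin n × Fin 4) ℤ :=
  Matrix.of fun c d => if c = d ∧ ¬ (c.2 = 0 ∧ c.1 ≠ r) then 1 else 0

theorem rot_mul_partialSum (r : Fin n) (c d : Fin n × Fin 4) :
    ((permMat (cornerRot n) - 1 + Matrix.single (r, 3) (r, 0) 1) * partialSum n :
      Matrix (Fin n × Fin 4) (Fin n × Fin 4) ℤ) c d =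
      if c.1 = d.1 then
        (if c.2 = 3 then (if d.2 = 0 then 0 else -1) + (if c.1 = r ∧ d.2 = 0 then 1 else 0)
          else if c.2 + 1 = d.2 then 1 else 0) else 0 := by
  obtain ⟨v, i⟩ := c
  obtain ⟨w, j⟩ := d
  rw [Matrix.add_mul, Matrix.add_apply, Matrix.sub_mul, Matrix.sub_apply, permMat_mul_apply,
    Matrix.one_mul]
  have hE : ((Matrix.single (r, 3) (r, 0) 1 : Matrix (Fin n × Fin 4) (Fin n × Fin 4) ℤ) *
      partialSum n) (v, i) (w, j) = if v = r ∧ i = 3 ∧ w = r ∧ j = 0 then 1 else 0 := by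
    by_cases h : v = r ∧ i = 3
    · obtain ⟨rfl, rfl⟩ := h
      simp [partialSum, eq_comm]
    · rw [Matrix.single_mul_apply_of_ne]
      · rw [if_neg (by tauto)]
      · intro h'
        exact h (by simpa using h')
  rw [hE]
  by_cases h : v = w
  · subst h
    fin_cases i <;> fin_cases j <;> simp [cornerRot, partialSum]
  · have : ¬ (v = r ∧ i = 3 ∧ w = r ∧ j = 0) := fun h' => h (h'.1.trans h'.2.2.1.symm)
    simp [cornerRot, partialSum, h, this]

/-- At each vertex `P - 1` has corank one: its rows add up to zero. The extra entry repairs this at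
the root only, so one zero remains for each hypermomentum. -/
theorem rowSum_mul_rot_mul_partialSum (r : Fin n) :
    rowSum r * ((permMat (cornerRot n) - 1 + Matrix.single (r, 3) (r, 0) 1) * partialSum n) =
      offRoot r := by
  ext ⟨v, i⟩ ⟨w, j⟩
  by_cases hi : i = 0
  · subst hi
    by_cases hv : v = r
    · subst hv
      rw [rowSum_mul_root]
      simp only [rot_mul_partialSum, Fintype.sum_prod_type]
      rw [Finset.sum_eq_single w (fun x _ hx => by simp [hx]) (by simp)]
      fin_cases j <;> simp [Fin.sum_univ_four, offRoot, eq_comm]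
    · rw [rowSum_mul_zero hv]
      simp only [rot_mul_partialSum]
      by_cases h : v = w
      · subst h
        fin_cases j <;> simp [Fin.sum_univ_four, offRoot, hv]
      · simp [h, offRoot]
  · rw [rowSum_mul_succ _ _ _ hi, rot_mul_partialSum]
    by_cases h : v = w
    · subst h
      fin_cases i <;> fin_cases j <;> simp [offRoot] at hi ⊢
    · simp [h, offRoot]

/-- The indicator matrix of the corners of each vertex other than the root. -/
def vertexMat (r : Fin n) : Matrix (Fin n × Fin 4) {v : Fin n // v ≠ r} ℤ :=
  Matrix.of fun c v => if c.1 = v.1 then 1 else 0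

/-- The oscillation form of the lines and hypermomenta, in terms of the signed incidence matrix `K`
of the corners and the lines. -/
def oscForm (r : Fin n) (K : Matrix (Fin n × Fin 4) S ℤ) :
    Matrix (S ⊕ {v : Fin n // v ≠ r}) (S ⊕ {v : Fin n // v ≠ r}) ℤ :=
  fromBlocks (-(Kᵀ * orderMat n * K)) (Kᵀ * vertexMat r) (-((vertexMat r)ᵀ * K)) 0

/-- The root row is the sum over all corners, which vanishes for every line. -/
theorem rowSum_mul_lastSum (r : Fin n) (K : Matrix (Fin n × Fin 4) S ℤ)
    (h3 : ∀ l, ∑ c, K c l = 0) (c : Fin n × Fin 4) (l : S) :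
    (rowSum r * (lastSum n * K)) c l = if c.2 = 0 ∧ c.1 ≠ r then ∑ i, K (c.1, i) l else 0 := by
  have h : ∀ v i, (lastSum n * K) (v, i) l = if i = 3 then ∑ j, K (v, j) l else 0 := by
    intro v i
    rw [Matrix.mul_apply, Fintype.sum_prod_type, Finset.sum_eq_single v]
    · simp [lastSum]
    · intro w _ hw
      simp [lastSum, hw.symm]
    · simp
  obtain ⟨v, i⟩ := c
  by_cases hi : i = 0
  · subst hi
    by_cases hv : v = r
    · subst hv
      rw [rowSum_mul_root, Fintype.sum_prod_type]
      simp only [h]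
      have := h3 l
      rw [Fintype.sum_prod_type] at this
      simpa using this
    · rw [rowSum_mul_zero hv]
      simp [h, hv]
  · rw [rowSum_mul_succ _ _ _ hi, h]
    fin_cases i <;> simp at hi ⊢

/-- Unimodular operations on the corners reduce the corner block to `offRoot r`. Its unit entries
split off; the first corners of the other vertices become the hypermomenta, and the coefficient `2`
of `lastSum` gives one factor `2` for each of their rows. -/
theorem det_cornerForm_eq_det_oscForm (r : Fin n) (K : Matrix (Fin n × Fin 4) S ℤ)
    (h3 : ∀ l, ∑ c, K c l = 0) :
    |(fromBlocks (permMat (cornerRot n) - 1 + Matrix.single (r, 3) (r, 0) 1)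
      (-(2 • (lastSum n * K))) Kᵀ (-(Kᵀ * orderMat n * K))).det| =
    2 ^ Fintype.card {v : Fin n // v ≠ r} * |(oscForm r K).det| := by
  set A : Matrix (Fin n × Fin 4) (Fin n × Fin 4) ℤ :=
    permMat (cornerRot n) - 1 + Matrix.single (r, 3) (r, 0) 1 with hA
  set B := fromBlocks A (-(2 • (lastSum n * K))) Kᵀ (-(Kᵀ * orderMat n * K)) with hB
  set T := fromBlocks (offRoot r) (-(2 • (rowSum r * (lastSum n * K)))) (Kᵀ * partialSum n)
    (-(Kᵀ * orderMat n * K)) with hT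
  have hprod : fromBlocks (rowSum r) 0 0 (1 : Matrix S S ℤ) * B *
      fromBlocks (partialSum n) 0 0 (1 : Matrix S S ℤ) = T := by
    rw [hB, hT, fromBlocks_multiply, fromBlocks_multiply]
    congr 1
    · rw [← rowSum_mul_rot_mul_partialSum r, ← hA]
      simp [Matrix.mul_assoc]
    · simp
    · simp
    · simp
  have hdet := congrArg (fun M => |det M|) hprod
  simp only [det_mul, det_fromBlocks_zero₂₁, det_one, mul_one, abs_mul, abs_det_rowSum,
    abs_det_partialSum, one_mul] at hdet
  rw [hdet]
  -- The predicate selects the corners at which the corner block is the identity.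
  let p : (Fin n × Fin 4) ⊕ S → Prop := Sum.elim (fun c => ¬ (c.2 = 0 ∧ c.1 ≠ r)) fun _ => False
  have : DecidablePred p := Classical.decPred p
  have htri := twoBlockTriangular_det' T p (by
    rintro (⟨v, i⟩ | l) hi (⟨w, j⟩ | l') hj
    · simp only [p, Sum.elim_inl] at hi hj
      simp only [hT, fromBlocks_apply₁₁, offRoot, of_apply]
      rw [if_neg]
      rintro ⟨h, -⟩
      obtain ⟨rfl, rfl⟩ := Prod.mk.inj h
      exact hj hi
    · simp only [p, Sum.elim_inl] at hi
      simp only [hT, fromBlocks_apply₁₂, Matrix.neg_apply, Matrix.smul_apply]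
      rw [rowSum_mul_lastSum _ _ h3, if_neg hi]
      simp
    · simp [p] at hi
    · simp [p] at hi)
  have hone : toSquareBlockProp T p = 1 := by
    ext ⟨x, hx⟩ ⟨y, hy⟩
    rcases x with c | l
    · rcases y with d | l'
      · simp only [p, Sum.elim_inl] at hx hy
        simp only [toSquareBlockProp, toBlock_apply, hT, fromBlocks_apply₁₁,
          offRoot, of_apply, Matrix.one_apply, hx, not_false_eq_true, and_true]
        by_cases h : c = d
        · subst h; simp
        · rw [if_neg h, if_neg fun h' => h (Sum.inl.inj (congrArg Subtype.val h'))]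
      · simp [p] at hy
    · simp [p] at hx
  let ψ : S ⊕ {v : Fin n // v ≠ r} ≃ {x // ¬ p x} :=
    { toFun := Sum.elim (fun l => ⟨Sum.inr l, by simp [p]⟩)
        fun v => ⟨Sum.inl (v.1, 0), by simp [p, v.2]⟩
      invFun := fun x => match x with
        | ⟨Sum.inl c, h⟩ => Sum.inr ⟨c.1, (not_not.1 h).2⟩
        | ⟨Sum.inr l, _⟩ => Sum.inl l
      left_inv := by rintro (l | v) <;> rfl
      right_inv := by
        rintro ⟨⟨v, i⟩ | l, h⟩
        · have : i = 0 := (not_not.1 h).1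
          subst this
          rfl
        · rfl }
  have hblock : (toSquareBlockProp T fun x => ¬ p x).submatrix ψ ψ =
      fromBlocks 1 0 0 (2 • (1 : Matrix {v : Fin n // v ≠ r} {v : Fin n // v ≠ r} ℤ)) *
        oscForm r K := by
    rw [oscForm, fromBlocks_multiply]
    simp only [Matrix.smul_mul, Matrix.one_mul, Matrix.zero_mul, zero_add, add_zero, smul_neg,
      smul_zero]
    ext x y
    rcases x with l | v
    · rcases y with l' | w
      · simp [toSquareBlockProp, ψ, hT]
      · simp [toSquareBlockProp, ψ, hT, Matrix.mul_apply, partialSum, vertexMat]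
    · rcases y with l' | w
      · simp only [toSquareBlockProp, ψ, hT, submatrix_apply, toBlock_apply, Equiv.coe_fn_mk,
          Sum.elim_inl, Sum.elim_inr, fromBlocks_apply₁₂, fromBlocks_apply₂₁, Matrix.neg_apply,
          Matrix.smul_apply]
        rw [rowSum_mul_lastSum _ _ h3, if_pos ⟨rfl, v.2⟩]
        have : ((vertexMat r)ᵀ * K) v l' = ∑ i, K (v.1, i) l' := by
          rw [Matrix.mul_apply, Fintype.sum_prod_type, Finset.sum_eq_single v.1]
          · simp [vertexMat]
          · intro w _ hw
            simp [vertexMat, hw]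
          · simp
        rw [this]
      · simp only [toSquareBlockProp, ψ, hT, submatrix_apply, toBlock_apply, Equiv.coe_fn_mk,
          Sum.elim_inr, fromBlocks_apply₁₁, fromBlocks_apply₂₂, Matrix.zero_apply, offRoot, of_apply]
        exact if_neg fun h => h.2 ⟨trivial, v.2⟩
  rw [htri, hone, det_one, one_mul, ← det_submatrix_equiv_self ψ, hblock, det_mul,
    det_fromBlocks_zero₂₁, det_one, one_mul, det_smul_of_tower, abs_mul]
  simp

/-- The determinant of the oscillation form. -/
theorem two_pow_mul_abs_det_oscForm (r : Fin n) (α : Equiv.Perm (Fin n × Fin 4))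
    (hα : ∀ c, α (α c) = c) (K : Matrix (Fin n × Fin 4) S ℤ) (h1 : Kᵀ * K = 2 • (1 : Matrix S S ℤ))
    (h2 : K * Kᵀ = 1 - permMat α) (h3 : ∀ l, ∑ c, K c l = 0) :
    ((∀ c d, (cornerRot n * α).SameCycle c d) →
      2 ^ (n - 1) * |(oscForm r K).det| = 2 ^ Fintype.card S) ∧
    ((¬ ∀ c d, (cornerRot n * α).SameCycle c d) → (oscForm r K).det = 0) := by
  have e := det_cornerForm_eq_det_oscForm r K h3
  rw [det_cornerForm r α K h1 h2 h3, abs_mul, abs_pow, abs_two,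
    show Fintype.card {v : Fin n // v ≠ r} = n - 1 by simp [Fintype.card_subtype_compl]] at e
  constructor
  · intro h
    rw [← e, abs_det_of_sameCycle _ _ hα h, mul_one]
  · intro h
    rw [det_of_not_sameCycle _ _ hα _ _ h, abs_zero, mul_zero] at e
    exact abs_eq_zero.1 ((mul_eq_zero.1 e.symm).resolve_left (by positivity))

end Oscillation

/-! ### Cycles of a permutation multiplied by a transposition. -/

section Cycles

open Equiv Equiv.Perm

variable {D : Type*} [Fintype D] [DecidableEq D]

/-- The number of cycles of a permutation, fixed points included. -/
noncomputable def numCycles (σ : Perm D) : ℕ := Nat.card (Quotient (SameCycle.setoid σ))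

theorem sameCycle_induction {σ : Perm D} {x y : D} (h : σ.SameCycle x y) {p : D → Prop}
    (hx : p x) (step : ∀ z, p z → p (σ z)) : p y := by
  obtain ⟨k, rfl⟩ := h.exists_nat_pow_eq
  induction k with
  | zero => exact hx
  | succ k ih =>
    rw [pow_succ', Perm.mul_apply]
    exact step _ (ih ⟨k, by simp⟩)

theorem mul_swap_apply_of_ne {σ : Perm D} {a b z : D} (ha : z ≠ a) (hb : z ≠ b) :
    (σ * swap a b) z = σ z := by
  rw [Perm.mul_apply, swap_apply_of_ne_of_ne ha hb]

theorem mul_swap_left (σ : Perm D) (a b : D) : (σ * swap a b) a = σ b := by simp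

theorem mul_swap_right (σ : Perm D) (a b : D) : (σ * swap a b) b = σ a := by simp

/-- Composition with a transposition joins two cycles. -/
theorem sameCycle_mul_swap_of_not {σ : Perm D} {a b : D} (h : ¬ σ.SameCycle a b) :
    (σ * swap a b).SameCycle a b := by
  classical
  obtain ⟨k₀, hk₀, -, hk₀'⟩ := (SameCycle.refl σ b).exists_pow_eq''
  have hex : ∃ k, 0 < k ∧ (σ ^ k) b = b := ⟨k₀, hk₀, hk₀'⟩
  obtain ⟨hpos, hk⟩ := Nat.find_spec hex
  have hmin : ∀ j, 0 < j → j < Nat.find hex → (σ ^ j) b ≠ b := fun j h0 hj h' =>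
    Nat.find_min hex hj ⟨h0, h'⟩
  -- Starting from `a`, the product jumps to `σ b` and follows the cycle of `b`, which avoids `a`,
  -- until it first returns to `b`.
  have key : ∀ j, j + 1 ≤ Nat.find hex → ((σ * swap a b) ^ (j + 1)) a = (σ ^ (j + 1)) b := by
    intro j
    induction j with
    | zero => intro _; simp
    | succ j ih =>
      intro hj
      rw [pow_succ', Perm.mul_apply, ih (by omega), mul_swap_apply_of_ne,
        pow_succ' σ (j + 1), Perm.mul_apply]
      · intro h'
        exact h (h' ▸ (sameCycle_pow_right.2 (SameCycle.refl σ b))).symm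
      · exact hmin _ (Nat.succ_pos _) (by omega)
  obtain ⟨m, hm⟩ : ∃ m, Nat.find hex = m + 1 := ⟨Nat.find hex - 1, by omega⟩
  have := key m hm.ge
  rw [← hm, hk] at this
  exact ⟨(Nat.find hex : ℕ), by rw [zpow_natCast]; exact this⟩

/-- Composition with a transposition splits a cycle. -/
theorem not_sameCycle_mul_swap {σ : Perm D} {a b : D} (hab : a ≠ b) (h : σ.SameCycle a b) :
    ¬ (σ * swap a b).SameCycle a b := by
  classical
  obtain ⟨k₀, hk₀, -, hk₀'⟩ := h.exists_pow_eq''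
  have hex : ∃ k, 0 < k ∧ (σ ^ k) a = b := ⟨k₀, hk₀, hk₀'⟩
  obtain ⟨hpos, hk⟩ := Nat.find_spec hex
  have hmin : ∀ j, 0 < j → j < Nat.find hex → (σ ^ j) a ≠ b := fun j h0 hj h' =>
    Nat.find_min hex hj ⟨h0, h'⟩
  have hna : ∀ j, 0 < j → j ≤ Nat.find hex → (σ ^ j) a ≠ a := by
    intro j h0 hj h'
    have hlt : j < Nat.find hex := lt_of_le_of_ne hj fun e => hab (by rw [← h', e, hk])
    refine hmin (Nat.find hex - j) (by omega) (by omega) ?_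
    have : (σ ^ (Nat.find hex - j)) ((σ ^ j) a) = b := by
      rw [← Perm.mul_apply, ← pow_add, Nat.sub_add_cancel hj, hk]
    rwa [h'] at this
  intro h'
  -- The arc of `σ` that starts just after `a` and ends at `b` is closed under the product and does
  -- not contain `a`.
  obtain ⟨j, h0, hj, hja⟩ : ∃ j, 0 < j ∧ j ≤ Nat.find hex ∧ (σ ^ j) a = a := by
    refine sameCycle_induction (p := fun z => ∃ j, 0 < j ∧ j ≤ Nat.find hex ∧ (σ ^ j) a = z)
      h'.symm ⟨_, hpos, le_rfl, hk⟩ ?_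
    rintro z ⟨j, h0, hj, rfl⟩
    rcases hj.lt_or_eq with hlt | rfl
    · rw [mul_swap_apply_of_ne (hna j h0 hj) (hmin j h0 hlt)]
      exact ⟨j + 1, by omega, hlt, by rw [pow_succ', Perm.mul_apply]⟩
    · rw [hk, mul_swap_right]
      exact ⟨1, one_pos, hpos, by simp⟩
  exact hna j h0 hj hja

theorem SameCycle.mul_swap {σ : Perm D} {a b x y : D} (h : ¬ σ.SameCycle a b)
    (hxy : σ.SameCycle x y) : (σ * swap a b).SameCycle x y := by
  have hab := sameCycle_mul_swap_of_not h
  refine sameCycle_induction hxy (SameCycle.refl _ _) fun z hz => ?_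
  by_cases ha : z = a
  · subst ha
    rw [← mul_swap_right σ z b]
    exact sameCycle_apply_right.2 (hz.trans hab)
  · by_cases hb : z = b
    · subst hb
      rw [← mul_swap_left σ a z]
      exact sameCycle_apply_right.2 (hz.trans hab.symm)
    · rw [← mul_swap_apply_of_ne (σ := σ) ha hb]
      exact sameCycle_apply_right.2 hz

theorem sameCycle_of_mul_swap {σ : Perm D} {a b x y : D} (hxy : (σ * swap a b).SameCycle x y) :
    σ.SameCycle x y ∨ (σ.SameCycle x a ∧ σ.SameCycle b y) ∨
      (σ.SameCycle x b ∧ σ.SameCycle a y) := by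
  refine sameCycle_induction (p := fun y => σ.SameCycle x y ∨
    (σ.SameCycle x a ∧ σ.SameCycle b y) ∨ (σ.SameCycle x b ∧ σ.SameCycle a y)) hxy
    (Or.inl (SameCycle.refl _ _)) fun z hz => ?_
  by_cases ha : z = a
  · subst ha
    rw [mul_swap_left]
    have hb : σ.SameCycle b (σ b) := sameCycle_apply_right.2 (SameCycle.refl _ _)
    rcases hz with hz | hz | hz
    · exact Or.inr (Or.inl ⟨hz, hb⟩)
    · exact Or.inl ((hz.1.trans hz.2.symm).trans hb)
    · exact Or.inl (hz.1.trans hb)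
  · by_cases hb : z = b
    · subst hb
      rw [mul_swap_right]
      have ha : σ.SameCycle a (σ a) := sameCycle_apply_right.2 (SameCycle.refl _ _)
      rcases hz with hz | hz | hz
      · exact Or.inr (Or.inr ⟨hz, ha⟩)
      · exact Or.inl (hz.1.trans ha)
      · exact Or.inl ((hz.1.trans hz.2.symm).trans ha)
    · rw [mul_swap_apply_of_ne ha hb]
      simpa only [sameCycle_apply_right] using hz

theorem numCycles_mul_swap_of_not {σ : Perm D} {a b : D} (h : ¬ σ.SameCycle a b) :
    numCycles (σ * swap a b) + 1 = numCycles σ := by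
  classical
  unfold numCycles
  let mk : D → Quotient (SameCycle.setoid σ) := Quotient.mk _
  have hmk : ∀ x y, mk x = mk y ↔ σ.SameCycle x y := fun x y => Quotient.eq
  let f : Quotient (SameCycle.setoid σ) → Quotient (SameCycle.setoid (σ * swap a b)) :=
    Quotient.map id fun _ _ hxy => SameCycle.mul_swap h hxy
  have hf : ∀ x y, f (mk x) = f (mk y) ↔ (σ * swap a b).SameCycle x y := fun x y => Quotient.eq
  -- The only identification is that of the cycles of `a` and `b`, so omitting the cycle of `b`
  -- makes the map bijective.
  have hbij : Function.Bijective fun q : {q // q ≠ mk b} => f q.1 := by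
    constructor
    · rintro ⟨q, hq⟩ ⟨q', hq'⟩ he
      induction q using Quotient.inductionOn with | _ x => ?_
      induction q' using Quotient.inductionOn with | _ y => ?_
      rw [Subtype.mk.injEq]
      rcases sameCycle_of_mul_swap ((hf x y).1 he) with h1 | h1 | h1
      · exact (hmk x y).2 h1
      · exact absurd ((hmk y b).2 h1.2.symm) hq'
      · exact absurd ((hmk x b).2 h1.1) hq
    · intro q
      induction q using Quotient.inductionOn with | _ x => ?_
      by_cases hx : mk x = mk b
      · refine ⟨⟨mk a, fun he => h ((hmk a b).1 he)⟩, ?_⟩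
        exact (hf a x).2 ((sameCycle_mul_swap_of_not h).trans
          (SameCycle.mul_swap h ((hmk x b).1 hx)).symm)
      · exact ⟨⟨mk x, hx⟩, rfl⟩
  rw [← Nat.card_congr (Equiv.ofBijective _ hbij)]
  have : Fintype (Quotient (SameCycle.setoid σ)) := Fintype.ofFinite _
  rw [Nat.card_eq_fintype_card, Nat.card_eq_fintype_card, Fintype.card_subtype_compl,
    Fintype.card_subtype_eq]
  have : 0 < Fintype.card (Quotient (SameCycle.setoid σ)) := Fintype.card_pos_iff.2 ⟨mk b⟩
  omega

theorem numCycles_mul_swap_of_sameCycle {σ : Perm D} {a b : D} (hab : a ≠ b)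
    (h : σ.SameCycle a b) : numCycles (σ * swap a b) = numCycles σ + 1 := by
  have := numCycles_mul_swap_of_not (not_sameCycle_mul_swap hab h)
  rw [mul_assoc, swap_mul_self, mul_one] at this
  exact this.symm

theorem numCycles_mul_swap_le (σ : Perm D) (a b : D) :
    numCycles (σ * swap a b) ≤ numCycles σ + 1 := by
  by_cases h : σ.SameCycle a b
  · by_cases hab : a = b
    · subst hab
      rw [swap_self]
      exact Nat.le_succ _
    · exact (numCycles_mul_swap_of_sameCycle hab h).le
  · have := numCycles_mul_swap_of_not h
    omega

/-- Each transposition changes the number of cycles by one, and the identity has as many cycles as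
points. -/
theorem sign_eq_neg_one_pow (σ : Perm D) :
    sign σ = (-1) ^ (Fintype.card D + numCycles σ) := by
  refine swap_induction_on' σ ?_ fun f x y hxy ih => ?_
  · have : numCycles (1 : Perm D) = Fintype.card D := by
      rw [numCycles, ← Nat.card_eq_fintype_card]
      refine (Nat.card_congr (Equiv.ofBijective (Quotient.mk _) ⟨fun x y h => ?_,
        Quotient.mk_surjective⟩)).symm
      exact sameCycle_one.1 (Quotient.exact h)
    rw [this, ← two_mul, pow_mul]
    simp
  · rw [Perm.sign_mul, sign_swap hxy, ih]
    by_cases h : f.SameCycle x y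
    · rw [numCycles_mul_swap_of_sameCycle hxy h, ← add_assoc, pow_succ]
    · rw [← numCycles_mul_swap_of_not h, ← add_assoc, pow_succ]
      simp

theorem numCycles_eq_one_iff [Nonempty D] {σ : Perm D} :
    numCycles σ = 1 ↔ ∀ c d, σ.SameCycle c d := by
  rw [numCycles, Nat.card_eq_one_iff_unique]
  constructor
  · rintro ⟨h, -⟩ c d
    exact Quotient.exact (h.elim (Quotient.mk _ c) (Quotient.mk _ d))
  · intro h
    refine ⟨⟨fun q q' => ?_⟩, ⟨Quotient.mk _ (Classical.arbitrary D)⟩⟩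
    induction q using Quotient.inductionOn
    induction q' using Quotient.inductionOn
    exact Quotient.sound (h _ _)

end Cycles

/-! ### Trees, boundary components and genus of a ribbon graph. -/

namespace RibbonGraph

open Equiv Equiv.Perm

variable {D E : Type*} [Fintype D] [DecidableEq D] [DecidableEq E] (G : RibbonGraph D E)

theorem source_ne_target (e e' : E) : G.source e ≠ G.target e' := fun h =>
  Sum.inl_ne_inr (G.ends_injective (a₁ := Sum.inl e) (a₂ := Sum.inr e') h)

theorem source_injective : Function.Injective G.source := fun e e' h =>
  Sum.inl_injective (G.ends_injective (a₁ := Sum.inl e) (a₂ := Sum.inl e') h)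

theorem target_injective : Function.Injective G.target := fun e e' h =>
  Sum.inr_injective (G.ends_injective (a₁ := Sum.inr e) (a₂ := Sum.inr e') h)

theorem prod_swap_apply_of_notMem (l : List E) (c : D)
    (h : ∀ e ∈ l, c ≠ G.source e ∧ c ≠ G.target e) :
    (l.map fun e => swap (G.source e) (G.target e)).prod c = c := by
  induction l with
  | nil => simp
  | cons a l ih =>
    rw [List.map_cons, List.prod_cons, Perm.mul_apply,
      ih fun e he => h e (List.mem_cons_of_mem _ he)]
    have := h a List.mem_cons_self
    exact swap_apply_of_ne_of_ne this.1 this.2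

theorem prod_swap_apply (l : List E) (hl : l.Nodup) (e : E) (he : e ∈ l) :
    (l.map fun e => swap (G.source e) (G.target e)).prod (G.source e) = G.target e ∧
      (l.map fun e => swap (G.source e) (G.target e)).prod (G.target e) = G.source e := by
  induction l with
  | nil => simp at he
  | cons a l ih =>
    rw [List.nodup_cons] at hl
    simp only [List.map_cons, List.prod_cons, Perm.mul_apply]
    by_cases hea : e = a
    · subst hea
      have hne : ∀ e' ∈ l, e ≠ e' := fun e' he' h => hl.1 (h ▸ he')
      rw [G.prod_swap_apply_of_notMem l _ fun e' he' =>
          ⟨fun h => hne e' he' (G.source_injective h), G.source_ne_target _ _⟩,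
        G.prod_swap_apply_of_notMem l _ fun e' he' =>
          ⟨(G.source_ne_target _ _).symm, fun h => hne e' he' (G.target_injective h)⟩]
      simp
    · have hel : e ∈ l := (List.mem_cons.1 he).resolve_left hea
      obtain ⟨h1, h2⟩ := ih hl.2 hel
      rw [h1, h2]
      exact ⟨swap_apply_of_ne_of_ne (G.source_ne_target _ _).symm
          fun h => hea (G.target_injective h),
        swap_apply_of_ne_of_ne (fun h => hea (G.source_injective h)) (G.source_ne_target _ _)⟩

theorem flip_source {S : Finset E} {e : E} (he : e ∈ S) :
    G.flip S (G.source e) = G.target e :=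
  (G.prod_swap_apply _ S.nodup_toList e (S.mem_toList.2 he)).1

theorem flip_target {S : Finset E} {e : E} (he : e ∈ S) :
    G.flip S (G.target e) = G.source e :=
  (G.prod_swap_apply _ S.nodup_toList e (S.mem_toList.2 he)).2

theorem flip_of_forall_ne {S : Finset E} {c : D}
    (h : ∀ e ∈ S, c ≠ G.source e ∧ c ≠ G.target e) : G.flip S c = c :=
  G.prod_swap_apply_of_notMem _ _ fun e he => h e (S.mem_toList.1 he)

theorem flip_source_of_notMem {S : Finset E} {e : E} (he : e ∉ S) :
    G.flip S (G.source e) = G.source e :=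
  G.flip_of_forall_ne fun _ he' =>
    ⟨fun h => he (G.source_injective h ▸ he'), G.source_ne_target _ _⟩

theorem flip_target_of_notMem {S : Finset E} {e : E} (he : e ∉ S) :
    G.flip S (G.target e) = G.target e :=
  G.flip_of_forall_ne fun _ he' =>
    ⟨(G.source_ne_target _ _).symm, fun h => he (G.target_injective h ▸ he')⟩

theorem corner_cases (c : D) : (∃ e, c = G.source e) ∨ (∃ e, c = G.target e) ∨
    ∀ e, c ≠ G.source e ∧ c ≠ G.target e := by
  by_cases h1 : ∃ e, c = G.source e
  · exact Or.inl h1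
  · by_cases h2 : ∃ e, c = G.target e
    · exact Or.inr (Or.inl h2)
    · push Not at h1 h2
      exact Or.inr (Or.inr fun e => ⟨h1 e, h2 e⟩)

theorem flip_flip_apply (S : Finset E) (c : D) : G.flip S (G.flip S c) = c := by
  rcases G.corner_cases c with ⟨e, rfl⟩ | ⟨e, rfl⟩ | h
  · by_cases he : e ∈ S
    · rw [G.flip_source he, G.flip_target he]
    · rw [G.flip_source_of_notMem he, G.flip_source_of_notMem he]
  · by_cases he : e ∈ S
    · rw [G.flip_target he, G.flip_source he]
    · rw [G.flip_target_of_notMem he, G.flip_target_of_notMem he]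
  · rw [G.flip_of_forall_ne fun e _ => h e, G.flip_of_forall_ne fun e _ => h e]

theorem flip_mul_flip {S T : Finset E} (h : Disjoint S T) :
    G.flip S * G.flip T = G.flip (S ∪ T) := by
  ext c
  rw [Perm.mul_apply]
  rcases G.corner_cases c with ⟨e, rfl⟩ | ⟨e, rfl⟩ | h'
  · by_cases hT : e ∈ T
    · have hS : e ∉ S := fun hS => Finset.disjoint_left.1 h hS hT
      rw [G.flip_source hT, G.flip_target_of_notMem hS, G.flip_source (by simp [hT])]
    · rw [G.flip_source_of_notMem hT]
      by_cases hS : e ∈ S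
      · rw [G.flip_source hS, G.flip_source (by simp [hS])]
      · rw [G.flip_source_of_notMem hS, G.flip_source_of_notMem (by simp [hS, hT])]
  · by_cases hT : e ∈ T
    · have hS : e ∉ S := fun hS => Finset.disjoint_left.1 h hS hT
      rw [G.flip_target hT, G.flip_source_of_notMem hS, G.flip_target (by simp [hT])]
    · rw [G.flip_target_of_notMem hT]
      by_cases hS : e ∈ S
      · rw [G.flip_target hS, G.flip_target (by simp [hS])]
      · rw [G.flip_target_of_notMem hS, G.flip_target_of_notMem (by simp [hS, hT])]
  · rw [G.flip_of_forall_ne fun e _ => h' e, G.flip_of_forall_ne fun e _ => h' e,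
      G.flip_of_forall_ne fun e _ => h' e]

theorem flip_mul_self (S : Finset E) : G.flip S * G.flip S = 1 :=
  Equiv.ext (G.flip_flip_apply S)

theorem flip_insert {S : Finset E} {e : E} (he : e ∉ S) :
    G.flip (insert e S) = G.flip S * swap (G.source e) (G.target e) := by
  have : G.flip {e} = swap (G.source e) (G.target e) := by simp [flip]
  rw [← this, G.flip_mul_flip (Finset.disjoint_singleton_right.2 he), Finset.union_comm]
  rfl

theorem flip_empty : G.flip ∅ = 1 := by simp [flip]

theorem sign_flip (S : Finset E) : sign (G.flip S) = (-1) ^ S.card := by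
  induction S using Finset.induction_on with
  | empty => simp [flip_empty]
  | insert e S he ih =>
    rw [G.flip_insert he, Perm.sign_mul, ih, sign_swap (G.source_ne_target e e),
      Finset.card_insert_of_notMem he, pow_succ]

theorem even_numCycles_mul_flip (σ : Perm D) (S : Finset E) :
    Even (numCycles (σ * G.flip S) + numCycles σ + S.card) := by
  have h := sign_eq_neg_one_pow (σ * G.flip S)
  rw [Perm.sign_mul, G.sign_flip, sign_eq_neg_one_pow σ, ← pow_add] at h
  have h' : (-1 : ℤˣ) ^ (numCycles (σ * G.flip S) + numCycles σ + S.card) = 1 := by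
    have : (-1 : ℤˣ) ^ (Fintype.card D + Fintype.card D) = 1 := by
      rw [← two_mul, pow_mul]; simp
    calc (-1 : ℤˣ) ^ (numCycles (σ * G.flip S) + numCycles σ + S.card)
        = (-1 : ℤˣ) ^ (Fintype.card D + Fintype.card D) *
          (-1 : ℤˣ) ^ (numCycles (σ * G.flip S) + numCycles σ + S.card) := by rw [this, one_mul]
      _ = (-1) ^ (Fintype.card D + numCycles (σ * G.flip S)) *
          (-1) ^ (Fintype.card D + numCycles σ + S.card) := by
        rw [← pow_add, ← pow_add]; congr 1; ring
      _ = 1 := by rw [h, ← pow_add, ← two_mul, pow_mul]; simp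
  rcases Nat.even_or_odd (numCycles (σ * G.flip S) + numCycles σ + S.card) with h1 | h1
  · exact h1
  · rw [h1.neg_one_pow] at h'
    exact absurd h' (by decide)

theorem numCycles_mul_flip_le (σ : Perm D) (S : Finset E) :
    numCycles (σ * G.flip S) ≤ numCycles σ + S.card := by
  induction S using Finset.induction_on with
  | empty => simp [flip_empty]
  | insert e S he ih =>
    rw [G.flip_insert he, ← mul_assoc, Finset.card_insert_of_notMem he]
    exact (numCycles_mul_swap_le _ _ _).trans (by omega)

theorem numVertices_eq : G.numVertices = numCycles G.rot := rfl

theorem numFaces_eq : G.numFaces = numCycles G.faceRot := rfl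

theorem adj_graphOf {S : Finset E} {e : E} (he : e ∈ S)
    (hne : (Quotient.mk _ (G.source e) : G.Vertex) ≠ Quotient.mk _ (G.target e)) :
    (G.graphOf S).Adj (Quotient.mk _ (G.source e)) (Quotient.mk _ (G.target e)) := by
  rw [graphOf, SimpleGraph.fromRel_adj]
  exact ⟨hne, Or.inl ⟨e, he, rfl, rfl⟩⟩

theorem reachable_graphOf {S : Finset E} {e : E} (he : e ∈ S) :
    (G.graphOf S).Reachable (Quotient.mk _ (G.source e)) (Quotient.mk _ (G.target e)) := by
  by_cases h : (Quotient.mk _ (G.source e) : G.Vertex) = Quotient.mk _ (G.target e)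
  · rw [h]
  · exact (G.adj_graphOf he h).reachable

/-- If the surface made of the vertices and of the lines of `S` has only one boundary component,
then it is connected. -/
theorem connected_graphOf [Nonempty D] {S : Finset E}
    (h : ∀ c d, (G.rot * G.flip S).SameCycle c d) : (G.graphOf S).Connected := by
  have : Nonempty G.Vertex := ⟨Quotient.mk _ (Classical.arbitrary D)⟩
  refine ⟨fun q q' => ?_⟩
  induction q using Quotient.inductionOn with | _ x => ?_
  induction q' using Quotient.inductionOn with | _ y => ?_
  refine sameCycle_induction (p := fun z => (G.graphOf S).Reachable (Quotient.mk _ x)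
    (Quotient.mk _ z)) (h x y) (SimpleGraph.Reachable.refl _) fun z hz => ?_
  have hrot : ∀ w, (Quotient.mk _ (G.rot w) : G.Vertex) = Quotient.mk _ w := fun w =>
    Quotient.sound (sameCycle_apply_left.2 (SameCycle.refl _ _))
  rw [Perm.mul_apply, hrot]
  refine hz.trans ?_
  rcases G.corner_cases z with ⟨e, rfl⟩ | ⟨e, rfl⟩ | h'
  · by_cases he : e ∈ S
    · rw [G.flip_source he]; exact G.reachable_graphOf he
    · rw [G.flip_source_of_notMem he]
  · by_cases he : e ∈ S
    · rw [G.flip_target he]; exact (G.reachable_graphOf he).symm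
    · rw [G.flip_target_of_notMem he]
  · rw [G.flip_of_forall_ne fun e _ => h' e]

/-- Lines of a connected graph can be chosen which merge all the vertices into a disk. -/
theorem exists_merging_lines [Nonempty D] {S : Finset E} (h : (G.graphOf S).Connected) :
    ∃ T ⊆ S, (∀ c d, (G.rot * G.flip T).SameCycle c d) ∧ T.card + 1 = G.numVertices := by
  classical
  -- These sets are forests in the language of permutations: every line has merged two different
  -- cycles. For a maximal one, every line of `S` has both ends on one cycle, and connectedness
  -- leaves only one.
  let P : Finset E → Prop := fun T =>
    numCycles (G.rot * G.flip T) + T.card = numCycles G.rot ∧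
    (∀ c d, G.rot.SameCycle c d → (G.rot * G.flip T).SameCycle c d) ∧
    ∀ e ∈ T, (G.rot * G.flip T).SameCycle (G.source e) (G.target e)
  obtain ⟨T, hT, hmax⟩ := Finset.exists_max_image (S.powerset.filter P) Finset.card
    ⟨∅, by simp [P, flip_empty]⟩
  simp only [Finset.mem_filter, Finset.mem_powerset] at hT hmax
  obtain ⟨hTS, h1, h2, h3⟩ := hT
  have hall : ∀ e ∈ S, (G.rot * G.flip T).SameCycle (G.source e) (G.target e) := by
    intro e he
    by_contra hcon
    have heT : e ∉ T := fun heT => hcon (h3 e heT)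
    have hins : G.rot * G.flip (insert e T) =
        G.rot * G.flip T * swap (G.source e) (G.target e) := by
      rw [G.flip_insert heT, mul_assoc]
    have := hmax (insert e T) ⟨Finset.insert_subset he hTS, ?_, ?_, ?_⟩
    · rw [Finset.card_insert_of_notMem heT] at this
      omega
    · rw [hins, Finset.card_insert_of_notMem heT, ← h1, ← numCycles_mul_swap_of_not hcon]
      omega
    · intro c d hcd
      rw [hins]
      exact SameCycle.mul_swap hcon (h2 c d hcd)
    · intro e' he'
      rw [hins]
      rcases Finset.mem_insert.1 he' with rfl | he'
      · exact sameCycle_mul_swap_of_not hcon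
      · exact SameCycle.mul_swap hcon (h3 e' he')
  have hone : ∀ c d, (G.rot * G.flip T).SameCycle c d := by
    let f : G.Vertex → Quotient (SameCycle.setoid (G.rot * G.flip T)) :=
      Quotient.map id fun c d hcd => h2 c d hcd
    have hadj : ∀ q q', (G.graphOf S).Adj q q' → f q = f q' := by
      intro q q' hq
      rw [graphOf, SimpleGraph.fromRel_adj] at hq
      rcases hq.2 with ⟨e, he, rfl, rfl⟩ | ⟨e, he, rfl, rfl⟩
      · exact Quotient.sound (hall e he)
      · exact Quotient.sound (hall e he).symm
    have hreach : ∀ q q', (G.graphOf S).Reachable q q' → f q = f q' := by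
      rintro q q' ⟨w⟩
      induction w with
      | nil => rfl
      | cons hq _ ih => exact (hadj _ _ hq).trans ih
    intro c d
    exact Quotient.exact (hreach _ _ (h.preconnected (Quotient.mk _ c) (Quotient.mk _ d)))
  refine ⟨T, hTS, hone, ?_⟩
  rw [numVertices_eq, ← h1, numCycles_eq_one_iff.2 hone, add_comm]

/-- The admissible sets of lines are those whose removal leaves a single boundary component. -/
theorem isAdmissible_iff [Nonempty D] {J : Finset E} (hJ : J ⊆ G.lines) :
    G.IsAdmissible J ↔ ∀ c d, (G.rot * G.flip (G.lines \ J)).SameCycle c d := by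
  -- Contraction moves the exchange of the ends of `T` from the lines into the rotation, so the
  -- faces do not depend on `T`.
  have hface : ∀ T ⊆ G.lines \ J, ((G.remove J).contract T).faceRot =
      G.rot * G.flip (G.lines \ J) := by
    intro T hT
    change G.rot * G.flip T * G.flip ((G.lines \ J) \ T) = _
    rw [mul_assoc, G.flip_mul_flip Finset.disjoint_sdiff, Finset.union_sdiff_of_subset hT]
  constructor
  · rintro ⟨-, T, hT, -, hsuper⟩
    have := hsuper.2
    rw [numFaces_eq, hface T hT] at this
    exact numCycles_eq_one_iff.1 this
  · intro h
    -- The dual rotation already flips all lines; flipping `J` again undoes it there. Thus `J` in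
    -- the dual and its complement in the graph have the same boundary.
    have hdual : ∀ c d, (G.dual.rot * G.dual.flip J).SameCycle c d := by
      have : G.dual.rot * G.dual.flip J = G.rot * G.flip (G.lines \ J) := by
        change G.rot * G.flip G.lines * G.flip J = _
        rw [← Finset.sdiff_union_of_subset hJ, ← G.flip_mul_flip Finset.sdiff_disjoint,
          mul_assoc, mul_assoc, G.flip_mul_self, mul_one, Finset.sdiff_union_of_subset hJ]
      rw [this]; exact h
    obtain ⟨T', hT', h1', h2'⟩ := G.dual.exists_merging_lines (G.dual.connected_graphOf hdual)
    obtain ⟨T, hT, h1, h2⟩ := G.exists_merging_lines (G.connected_graphOf h)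
    refine ⟨⟨T', hT', hT'.trans hJ, G.dual.connected_graphOf h1', h2'⟩,
      T, hT, ⟨hT.trans Finset.sdiff_subset, G.connected_graphOf h1, h2⟩, ?_, ?_⟩
    · exact numCycles_eq_one_iff.2 h1
    · rw [numFaces_eq, hface T hT]
      exact numCycles_eq_one_iff.2 h

/-- The genus of a connected ribbon graph. -/
theorem exists_genus [Nonempty D] (h : G.IsConnected) :
    ∃ g : ℕ, (2 : ℤ) - 2 * g = G.numVertices - G.lines.card + G.numFaces := by
  obtain ⟨T, hT, h1, h2⟩ := G.exists_merging_lines h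
  -- The lines outside a tree start from a single cycle and create at most one new cycle each, which
  -- bounds the number of faces; parity then makes the genus an integer.
  have hle := G.numCycles_mul_flip_le (G.rot * G.flip T) (G.lines \ T)
  rw [mul_assoc, G.flip_mul_flip Finset.disjoint_sdiff, Finset.union_sdiff_of_subset hT,
    numCycles_eq_one_iff.2 h1, Finset.card_sdiff_of_subset hT] at hle
  have hcard := Finset.card_le_card hT
  have heven := G.even_numCycles_mul_flip G.rot G.lines
  change G.numFaces ≤ _ at hle
  change Even (G.numFaces + G.numVertices + _) at heven
  obtain ⟨k, hk⟩ := heven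
  refine ⟨1 + G.lines.card - k, ?_⟩
  have : k ≤ 1 + G.lines.card := by omega
  push_cast [this]
  omega

end RibbonGraph

/-! ### The cycles of the rotation are the vertices. -/

section

open Equiv Equiv.Perm

theorem sameCycle_cornerRot_iff {n : ℕ} {c d : Fin n × Fin 4} :
    (cornerRot n).SameCycle c d ↔ c.1 = d.1 := by
  constructor
  · intro h
    exact sameCycle_induction (p := fun z => c.1 = z.1) h rfl fun z hz => hz
  · obtain ⟨v, i⟩ := c
    obtain ⟨w, j⟩ := d
    rintro rfl
    have h : ∀ k, (cornerRot n).SameCycle (v, k) (v, k + 1) := fun k =>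
      sameCycle_apply_right.2 (SameCycle.refl _ _)
    have h0 : ∀ k, (cornerRot n).SameCycle (v, 0) (v, k) := by
      intro k
      fin_cases k
      · exact SameCycle.refl _ _
      · exact h 0
      · exact (h 0).trans (h 1)
      · exact ((h 0).trans (h 1)).trans (h 2)
    exact (h0 i).symm.trans (h0 j)

theorem numCycles_cornerRot (n : ℕ) : numCycles (cornerRot n) = n := by
  rw [numCycles]
  have : Function.Bijective (fun v : Fin n =>
      (Quotient.mk (SameCycle.setoid (cornerRot n)) (v, (0 : Fin 4)))) := by
    constructor
    · intro v w h
      exact sameCycle_cornerRot_iff.1 (Quotient.exact h)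
    · intro q
      induction q using Quotient.inductionOn with | _ c => ?_
      exact ⟨c.1, Quotient.sound (sameCycle_cornerRot_iff.2 rfl)⟩
  rw [← Nat.card_congr (Equiv.ofBijective _ this), Nat.card_fin]

end

/-! ### From the Pfaffian coefficient to the determinant of the oscillation form. -/

namespace Phi4Graph

open Finset Matrix

variable {n L : ℕ} (G : Phi4Graph n L)

/-- The signed incidence of the corners and the lines outside `J`; the sign of a line is the one of
the corner where it exits. -/
def incidence (s : Fin n × Fin 4 → ℤˣ) (J : Finset (Fin L)) :
    Matrix (Fin n × Fin 4) {l // l ∉ J} ℤ :=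
  Matrix.of fun c l => (s (G.source l) : ℤ) *
    ((if c = G.source l then 1 else 0) - if c = G.target l then 1 else 0)

theorem source_ne_target (l l' : Fin L) : G.source l ≠ G.target l' :=
  G.toRibbon.source_ne_target l l'

theorem source_inj {l l' : Fin L} : G.source l = G.source l' ↔ l = l' :=
  G.toRibbon.source_injective.eq_iff

theorem target_inj {l l' : Fin L} : G.target l = G.target l' ↔ l = l' :=
  G.toRibbon.target_injective.eq_iff

theorem eta_eq (l : Fin L) (c : Fin n × Fin 4) :
    G.eta l c = (if c = G.source l then 1 else 0) + if c = G.target l then 1 else 0 := by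
  unfold eta eps
  have := G.source_ne_target l l
  by_cases h1 : c = G.source l
  · subst h1; simp [this, this.symm]
  · by_cases h2 : c = G.target l
    · subst h2; simp [this.symm]
    · simp [h1, h2, Ne.symm h1, Ne.symm h2]

variable {s : Fin n × Fin 4 → ℤˣ}

theorem incidence_eq (hs : ∀ l, s (G.source l) = -s (G.target l)) (J : Finset (Fin L))
    (c : Fin n × Fin 4) (l : {l // l ∉ J}) : G.incidence s J c l = s c * G.eta l c := by
  rw [eta_eq]
  simp only [incidence, of_apply]
  have := G.source_ne_target l l
  by_cases h1 : c = G.source l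
  · subst h1; simp [this]
  · by_cases h2 : c = G.target l
    · subst h2; simp [this.symm, hs]
    · simp [h1, h2]

theorem sum_incidence (J : Finset (Fin L)) (l : {l // l ∉ J}) :
    ∑ c, G.incidence s J c l = 0 := by
  simp [incidence, ← mul_sum]

theorem unit_mul_self (u : ℤˣ) : (u : ℤ) * u = 1 := by
  rw [← Units.val_mul, Int.units_mul_self, Units.val_one]

theorem transpose_incidence_mul_self (J : Finset (Fin L)) :
    (G.incidence s J)ᵀ * G.incidence s J = 2 • (1 : Matrix {l // l ∉ J} {l // l ∉ J} ℤ) := by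
  ext l l'
  have key : ((G.incidence s J)ᵀ * G.incidence s J) l l' =
      ((s (G.source l) : ℤ) * s (G.source l')) * ∑ c,
        ((if c = G.source l then 1 else 0) - if c = G.target l then 1 else 0) *
        ((if c = G.source l' then 1 else 0) - if c = G.target l' then 1 else 0) := by
    rw [Matrix.mul_apply, mul_sum]
    refine sum_congr rfl fun c _ => ?_
    simp only [transpose_apply, incidence, of_apply]
    ring
  rw [key]
  simp only [sub_mul, ite_mul, one_mul, zero_mul, sum_sub_distrib, Finset.sum_ite_eq', mem_univ,
    if_true, source_inj, target_inj, G.source_ne_target, (G.source_ne_target _ _).symm, if_false]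
  by_cases h : l = l'
  · subst h
    simp
  · have : (l : Fin L) ≠ l' := fun h' => h (Subtype.ext h')
    simp [this, h]

/-- Each line contributes the block with `1` on the diagonal and `-1` off it at its two ends. The
ends of different lines are disjoint, and the sign of a line occurs squared. -/
theorem incidence_mul_transpose (J : Finset (Fin L)) :
    G.incidence s J * (G.incidence s J)ᵀ = 1 - permMat (G.toRibbon.flip (univ \ J)) := by
  ext c d
  have key : (G.incidence s J * (G.incidence s J)ᵀ) c d = ∑ l : {l // l ∉ J},
        ((if c = G.source l then 1 else 0) - if c = G.target l then 1 else 0) *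
        ((if d = G.source l then 1 else 0) - if d = G.target l then 1 else 0) := by
    rw [Matrix.mul_apply]
    refine sum_congr rfl fun l _ => ?_
    simp only [transpose_apply, incidence, of_apply]
    linear_combination (((if c = G.source l then (1 : ℤ) else 0) -
      if c = G.target l then 1 else 0) *
        ((if d = G.source l then 1 else 0) - if d = G.target l then 1 else 0)) *
          unit_mul_self (s (G.source l))
  rw [key]
  have hcases : (∃ e, c = G.source e) ∨ (∃ e, c = G.target e) ∨
      ∀ e, c ≠ G.source e ∧ c ≠ G.target e := G.toRibbon.corner_cases c
  have f1 : ∀ e, e ∉ J → G.toRibbon.flip (univ \ J) (G.source e) = G.target e := fun e he =>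
    G.toRibbon.flip_source (by simpa using he)
  have f2 : ∀ e, e ∉ J → G.toRibbon.flip (univ \ J) (G.target e) = G.source e := fun e he =>
    G.toRibbon.flip_target (by simpa using he)
  have f3 : ∀ e, e ∈ J → G.toRibbon.flip (univ \ J) (G.source e) = G.source e := fun e he =>
    G.toRibbon.flip_source_of_notMem (by simpa using he)
  have f4 : ∀ e, e ∈ J → G.toRibbon.flip (univ \ J) (G.target e) = G.target e := fun e he =>
    G.toRibbon.flip_target_of_notMem (by simpa using he)
  have f5 : (∀ e, c ≠ G.source e ∧ c ≠ G.target e) → G.toRibbon.flip (univ \ J) c = c := fun h =>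
    G.toRibbon.flip_of_forall_ne fun e _ => h e
  simp only [permMat, Matrix.sub_apply, of_apply, Matrix.one_apply]
  rcases hcases with ⟨e, rfl⟩ | ⟨e, rfl⟩ | h
  · by_cases he : e ∈ J
    · rw [f3 e he, sub_self]
      refine sum_eq_zero fun l _ => ?_
      have : e ≠ l := fun h => l.2 (h ▸ he)
      simp [source_inj, this, G.source_ne_target]
    · rw [f1 e he, sum_eq_single ⟨e, he⟩]
      · simp only [G.source_ne_target, if_true, if_false, sub_zero, one_mul, eq_comm (a := d)]
      · intro l _ hl
        have : e ≠ l := fun h => hl (Subtype.ext h.symm)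
        simp [source_inj, this, G.source_ne_target]
      · simp
  · by_cases he : e ∈ J
    · rw [f4 e he, sub_self]
      refine sum_eq_zero fun l _ => ?_
      have : e ≠ l := fun h => l.2 (h ▸ he)
      simp [target_inj, this, (G.source_ne_target _ _).symm]
    · rw [f2 e he, sum_eq_single ⟨e, he⟩]
      · simp only [(G.source_ne_target _ _).symm, if_true, if_false, eq_comm (a := d)]
        ring
      · intro l _ hl
        have : e ≠ l := fun h => hl (Subtype.ext h.symm)
        simp [target_inj, this, (G.source_ne_target _ _).symm]
      · simp
  · rw [f5 h, sub_self]
    refine sum_eq_zero fun l _ => ?_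
    rw [if_neg (h l).1, if_neg (h l).2]
    simp

theorem sign_eq (hs : ∀ v i, s (v, i + 1) = -s (v, i)) (v : Fin n) (i : Fin 4) :
    (s (v, i) : ℤ) = s (v, 0) * (-1) ^ (i : ℕ) := by
  have h1 : s (v, 1) = -s (v, 0) := hs v 0
  have h2 : s (v, 2) = -s (v, 1) := hs v 1
  have h3 : s (v, 3) = -s (v, 2) := hs v 2
  fin_cases i <;> simp [h1, h2, h3, pow_succ]

/-- Alternation gives `(-1)^(i+j) = s (v, i) * s (v, j)`, which distributes over the two incidence
factors. -/
theorem osc_eta (h1 : ∀ v i, s (v, i + 1) = -s (v, i)) (h2 : ∀ l, s (G.source l) = -s (G.target l))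
    (J : Finset (Fin L)) (l l' : {l // l ∉ J}) :
    osc G.eta G.eta l l' = -((G.incidence s J)ᵀ * orderMat n * G.incidence s J) l l' := by
  simp only [osc, of_apply]
  rw [Matrix.mul_assoc, Matrix.mul_apply, Fintype.sum_prod_type, ← sum_neg_distrib]
  refine sum_congr rfl fun v _ => ?_
  have : ∀ i, (orderMat n * G.incidence s J) (v, i) l' =
      ∑ j, if i ≠ j then omega i j * (s (v, j) * G.eta l' (v, j)) else 0 := by
    intro i
    rw [Matrix.mul_apply, Fintype.sum_prod_type, sum_eq_single v]
    · refine sum_congr rfl fun j _ => ?_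
      rw [G.incidence_eq h2]
      simp only [orderMat, of_apply, true_and]
      split_ifs <;> simp
    · intro w _ hw
      simp [orderMat, hw.symm]
    · simp
  simp only [this, transpose_apply, G.incidence_eq h2]
  rw [show (univ : Finset (Fin 4)).offDiag = univ.filter fun p => p.1 ≠ p.2 by ext; simp,
    sum_filter, Fintype.sum_prod_type, ← sum_neg_distrib]
  refine sum_congr rfl fun i _ => ?_
  rw [mul_sum, ← sum_neg_distrib]
  refine sum_congr rfl fun j _ => ?_
  by_cases hij : i = j
  · simp [hij]
  · simp only [ne_eq, hij, not_false_eq_true, if_true]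
    rw [sign_eq h1 v i, sign_eq h1 v j]
    linear_combination (omega i j * (-1) ^ (i : ℕ) * (-1) ^ (j : ℕ) * G.eta l (v, i) *
      G.eta l' (v, j)) * unit_mul_self (s (v, 0))

theorem hyp_eta (r : Fin n) (h1 : ∀ v i, s (v, i + 1) = -s (v, i))
    (h2 : ∀ l, s (G.source l) = -s (G.target l)) (J : Finset (Fin L)) (l : {l // l ∉ J})
    (v : {v : Fin n // v ≠ r}) :
    hyp r G.eta l v = ((G.incidence s J)ᵀ * vertexMat r) l v * s (v.1, 0) := by
  rw [Matrix.mul_apply, Fintype.sum_prod_type, sum_eq_single v.1]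
  · simp only [hyp, of_apply, sum_mul]
    refine sum_congr rfl fun i _ => ?_
    simp only [transpose_apply, G.incidence_eq h2, vertexMat, of_apply, if_true]
    rw [sign_eq h1]
    linear_combination (-(-1) ^ (i : ℕ) * G.eta l (v.1, i)) * unit_mul_self (s (v.1, 0))
  · intro w _ hw
    simp [vertexMat, hw]
  · simp

/-- The variables which are left when all the short variables are deleted. -/
noncomputable def remainingEquiv (r : Fin n) (J : Finset (Fin L)) :
    {l : Fin L // l ∉ J} ⊕ {v : Fin n // v ≠ r} ≃
      {x : Fin L ⊕ₗ (Fin L ⊕ₗ {v : Fin n // v ≠ r}) //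
        unlex x ∉ (univ : Finset (Fin L)).disjSum (J.disjSum ∅)} :=
  Equiv.ofBijective
    (Sum.elim (fun l => ⟨toLex (Sum.inr (toLex (Sum.inl l.1))), by simp [unlex, l.2]⟩)
      fun v => ⟨toLex (Sum.inr (toLex (Sum.inr v))), by simp [unlex]⟩) (by
    constructor
    · rintro (l | v) (l' | w) h <;> simp at h
      · rw [Subtype.ext h]
      · rw [h]
    · rintro ⟨x, hx⟩
      induction x using Lex.rec with | _ x => ?_
      rcases x with l | x
      · simp [unlex] at hx
      · induction x using Lex.rec with | _ x => ?_
        rcases x with l | v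
        · exact ⟨Sum.inl ⟨l, by simpa [unlex] using hx⟩, rfl⟩
        · exact ⟨Sum.inr v, rfl⟩)

theorem orderMat_transpose : (orderMat n)ᵀ = -orderMat n := by
  ext ⟨v, i⟩ ⟨w, j⟩
  by_cases h : v = w
  · subst h
    fin_cases i <;> fin_cases j <;> simp [orderMat, omega]
  · simp [orderMat, h, Ne.symm h]

theorem oscForm_transpose {S : Type*} [Fintype S] [DecidableEq S] (r : Fin n)
    (K : Matrix (Fin n × Fin 4) S ℤ) : (oscForm r K)ᵀ = -oscForm r K := by
  rw [oscForm, fromBlocks_transpose, fromBlocks_neg]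
  congr 1
  · simp [transpose_mul, orderMat_transpose, Matrix.mul_assoc]
  · simp [transpose_mul]
  · simp [transpose_mul]

/-- Up to a reordering of the variables, the remaining matrix is `oscForm` multiplied on both sides
by the diagonal matrix `Δ` of the signs `s (v, 0)` on the hypermomenta; neither change affects the
absolute value of the determinant. -/
theorem pfCoeff_sq (r : Fin n) (h1 : ∀ v i, s (v, i + 1) = -s (v, i))
    (h2 : ∀ l, s (G.source l) = -s (G.target l)) (J : Finset (Fin L)) :
    G.pfCoeff r univ J ^ 2 = |(oscForm r (G.incidence s J)).det| := by
  let Δ : Matrix ({l // l ∉ J} ⊕ {v : Fin n // v ≠ r}) ({l // l ∉ J} ⊕ {v : Fin n // v ≠ r}) ℤ :=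
    diagonal (Sum.elim (fun _ => 1) fun v => (s (v.1, 0) : ℤ))
  have hsub : ((G.oscMatrix r).submatrix
      (fun x : {x : Fin L ⊕ₗ (Fin L ⊕ₗ {v : Fin n // v ≠ r}) //
        unlex x ∉ (univ : Finset (Fin L)).disjSum (J.disjSum ∅)} => unlex x.1)
      (fun x => unlex x.1)).submatrix (remainingEquiv r J) (remainingEquiv r J) =
      Δ * oscForm r (G.incidence s J) * Δ := by
    ext x y
    rw [mul_diagonal, diagonal_mul]
    rcases x with l | v
    · rcases y with l' | w
      · change osc G.eta G.eta l l' = _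
        rw [G.osc_eta h1 h2]
        simp [oscForm]
      · change hyp r G.eta l w = _
        rw [G.hyp_eta r h1 h2 J l w]
        simp [oscForm]
    · rcases y with l' | w
      · change -hyp r G.eta l' v = _
        rw [G.hyp_eta r h1 h2 J l' v]
        have : ((G.incidence s J)ᵀ * vertexMat r) l' v =
            ((vertexMat r)ᵀ * G.incidence s J) v l' := by
          rw [← transpose_apply ((G.incidence s J)ᵀ * vertexMat r), transpose_mul,
            transpose_transpose]
        rw [this]
        simp [oscForm, mul_comm]
      · change (0 : ℤ) = _
        simp [oscForm]
  have hdet : |Δ.det| = 1 := by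
    rw [det_diagonal, abs_prod]
    refine prod_eq_one fun x _ => ?_
    rcases x with l | v
    · simp
    · exact Int.isUnit_iff_abs_eq.1 (Units.isUnit _)
  have hΔ : Δᵀ = Δ := diagonal_transpose _
  have hskew : (Δ * oscForm r (G.incidence s J) * Δ)ᵀ =
      -(Δ * oscForm r (G.incidence s J) * Δ) := by
    rw [transpose_mul, transpose_mul, oscForm_transpose, hΔ]
    simp [Matrix.mul_assoc]
  rw [pfCoeff, pfaffian_sq_eq_abs_det, ← det_submatrix_equiv_self (remainingEquiv r J), hsub,
    det_mul, det_mul, abs_mul, abs_mul, hdet, one_mul, mul_one]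
  rw [← hsub] at hskew
  ext x y
  have := congrFun (congrFun hskew ((remainingEquiv r J).symm x)) ((remainingEquiv r J).symm y)
  simpa using this

/-- The square of the Pfaffian is a power of two if a single face is left, and vanishes otherwise. -/
theorem two_pow_mul_pfCoeff_sq (r : Fin n) (hG : G.IsOrientable) (J : Finset (Fin L)) :
    (G.toRibbon.IsAdmissible J → 2 ^ (n - 1) * G.pfCoeff r univ J ^ 2 = 2 ^ (L - J.card)) ∧
    (¬ G.toRibbon.IsAdmissible J → G.pfCoeff r univ J = 0) := by
  obtain ⟨s, h1, h2⟩ := hG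
  have : Nonempty (Fin n × Fin 4) := ⟨(r, 0)⟩
  have hdet := two_pow_mul_abs_det_oscForm r (G.toRibbon.flip (univ \ J))
    (G.toRibbon.flip_flip_apply _) (G.incidence s J) (G.transpose_incidence_mul_self J)
    (G.incidence_mul_transpose J) (G.sum_incidence J)
  rw [G.toRibbon.isAdmissible_iff (subset_univ J), G.pfCoeff_sq r h1 h2]
  have hcard : Fintype.card {l : Fin L // l ∉ J} = L - J.card := by
    simp [Fintype.card_subtype_compl]
  rw [hcard] at hdet
  refine ⟨hdet.1, fun h => ?_⟩
  have h0 := G.pfCoeff_sq r h1 h2 J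
  rw [hdet.2 h, abs_zero] at h0
  exact pow_eq_zero_iff two_ne_zero |>.1 h0

theorem numVertices_toRibbon : G.toRibbon.numVertices = n := numCycles_cornerRot n

end Phi4Graph

theorem mainTheorem2 {n L : ℕ} (G : Phi4Graph n L) (r : Fin n)
    (hconn : G.toRibbon.IsConnected) (horient : G.IsOrientable) :
    ∃ g : ℕ, (2 : ℤ) - 2 * g = (n : ℤ) - L + G.F ∧
      ∀ J : Finset (Fin L),
        (G.pfCoeff r Finset.univ J ≠ 0 ↔ G.toRibbon.IsAdmissible J) ∧
        (G.toRibbon.IsAdmissible J →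
          (G.pfCoeff r Finset.univ J : ℚ) ^ 2 = 2 ^ (2 * (g : ℤ) - G.k J) ∧
          Even (G.k J) ∧ 0 ≤ G.k J ∧ G.k J ≤ 2 * (g : ℤ)) := by
  have : Nonempty (Fin n × Fin 4) := ⟨(r, 0)⟩
  have hn : 1 ≤ n := r.pos
  obtain ⟨g, hg⟩ := G.toRibbon.exists_genus hconn
  have hL : G.toRibbon.lines.card = L := by simp [Phi4Graph.toRibbon]
  rw [G.numVertices_toRibbon, hL] at hg
  change (2 : ℤ) - 2 * g = (n : ℤ) - L + G.F at hg
  refine ⟨g, hg, fun J => ?_⟩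
  obtain ⟨hpos, hzero⟩ := G.two_pow_mul_pfCoeff_sq r horient J
  have hJ : J.card ≤ L := by simpa using Finset.card_le_univ J
  refine ⟨⟨fun h => by_contra fun h' => h (hzero h'), fun h h0 => ?_⟩, fun h => ?_⟩
  · have := hpos h
    rw [h0] at this
    simp at this
    exact absurd this.symm (by positivity)
  -- The inclusion of the dual tree in `J` gives `F - 1 ≤ |J|`, that is `0 ≤ k_J`; that of the tree
  -- in the complement gives `n - 1 ≤ L - |J|`, that is `k_J ≤ 2g`.
  · obtain ⟨⟨T', hT', -, -, hT'c⟩, T, hT, ⟨-, -, hTc⟩, -⟩ := id h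
    have hk : G.k J = J.card - G.F + 1 := rfl
    have e1 := Finset.card_le_card hT'
    have e2 := Finset.card_le_card hT
    rw [G.numVertices_toRibbon] at hTc
    change T'.card + 1 = G.F at hT'c
    change T.card ≤ (Finset.univ \ J).card at e2
    rw [Finset.card_sdiff_of_subset (Finset.subset_univ J), Finset.card_univ, Fintype.card_fin] at e2
    refine ⟨?_, ?_, by omega, by omega⟩
    · have hp : (2 : ℚ) ^ (n - 1) * (G.pfCoeff r Finset.univ J : ℚ) ^ 2 = 2 ^ (L - J.card) := by
        exact_mod_cast hpos h
      have hexp : 2 * (g : ℤ) - G.k J = ((L - J.card : ℕ) : ℤ) - ((n - 1 : ℕ) : ℤ) := by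
        rw [hk]; push_cast [hJ, hn]; linarith
      rw [hexp, zpow_sub₀ two_ne_zero, zpow_natCast, zpow_natCast, ← hp,
        mul_div_cancel_left₀ _ (by positivity)]
    · have heven := G.toRibbon.even_numCycles_mul_flip G.toRibbon.rot (Finset.univ \ J)
      have hone : numCycles (G.toRibbon.rot * G.toRibbon.flip (Finset.univ \ J)) = 1 :=
        numCycles_eq_one_iff.2 ((G.toRibbon.isAdmissible_iff (Finset.subset_univ J)).1 h)
      rw [hone,
        Finset.card_sdiff_of_subset (Finset.subset_univ J), Finset.card_univ, Fintype.card_fin,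
        ← RibbonGraph.numVertices_eq, G.numVertices_toRibbon] at heven
      obtain ⟨m, hm⟩ := heven
      -- Here `2m = 1 + n + (L - |J|)`; with Euler's relation, twice the witness is `k_J`.
      exact ⟨g + n - m, by omega⟩
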